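/- Let $q\ge 3$ be an integer, $\lambda=2\cos(\pi/q)$, and let $G_q\subset \mathrm{PSL}_2(\mathbb R)$ be the Hecke triangle group generated by $S:z\mapsto -1/z$ and $T:z\mapsto z+\lambda$. For integers $a_j\neq0$ write $[a_1,a_2,\dots]=\lim_{N\to\infty}ST^{a_1}ST^{a_2}\cdots ST^{a_N}(0)$, and for a finite sequence $[a_1,\dots,a_N]=ST^{a_1}\cdots ST^{a_N}(0)$. *Coding.* Let $\lfloor x\rfloor=n$ mean $n<x\le n+1$ if $x>0$ and $n\le x<n+1$ if $x\le 0$, and put $\{x\}_\lambda=\lfloor x/\lambda+1/2\rfloor$, $F_q(0)=0$ and $F_q(x)=-\frac1x-\{-\frac1x\}_\lambda\lambda$ for $x\ne0$. The code $c_q(x)$ has the digits $a_0=\{x\}_\lambda$ and $a_j=\{-1/x_j\}_\lambda$ for $j\ge1$, where $x_1=x-a_0\lambda$ and $x_{j+1}=F_qx_j$; it stops if some $x_j=0$. If $a_0=0$ this digit is omitted, and a bar denotes periodic repetition. *Strongly reduced geodesics.* Let $h=\frac{q-2}2$, $\kappa=h$ for even $q$ and $h=\frac{q-3}2$, $\kappa=2h+1$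 for odd $q$. The forbidden blocks are $(\pm1)^h,\pm m$ ($m\ge1$) for even $q$, and $(\pm1)^{h+1}$ and $(\pm1)^h,\pm2,(\pm1)^h,\pm m$ ($m\ge1$) for odd $q$, with the same sign throughout a block. Let $R$ be the largest number $[b_1,b_2,\dots]$ (finite or infinite) whose digit sequence contains no forbidden block read backwards, and $r=R-\lambda$. Let $\varphi_0<\dots<\varphi_\kappa=0$ be the $F_q$-orbit of $-\lambda/2$ in increasing order and $r_1>\dots>r_\kappa=r$ the $F_q$-orbit of $r$ in decreasing order. Put $\Omega_j=[\varphi_{j-1},\varphi_j)\times[r_j,R]$, $\Omega_{-j}=-\Omega_j$ for $1\le j\le\kappa$, and $\Omega=\bigcup_{1\le|j|\le\kappa}\Omega_j$. Let $\Omega^*$ be the set of pairs $(\xi,\eta)$ of real numbers, $\xi,\eta\notin G_q(\infty)$, with $(S\xi,-\eta)\in\Omega$. The oriented geodesic $\gamma(\xi,\eta)$ of the upper half-plane from $\eta$ to $\xi$ is called strongly reduced if $(\xi,\eta)\in\Omega^*$ and, moreover, $|\xi|>\frac{3\lambda}2$ or $\xi\eta<0$. (No further condition is imposed to make a choice between two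 $G_q$-equivalent geodesics of this kind with $\eta$ equivalent to $\pm r$.) **Lemma.** Let $\gamma=\gamma(\xi,\eta)$ be a strongly reduced geodesic whose projection to $G_q\backslash\mathbb H$ is closed, and suppose that $c_q(S\xi)=[\overline{a_1,\dots,a_n}]$ with minimal period $n$. Put $\xi_j=SF_q^jS\xi$. Then the $\lambda$-fractions below converge, and the hyperbolic length $l(\gamma)$ of the closed geodesic on $G_q\backslash\mathbb H$ given by $\gamma$ (the length of one full traversal, i.e. the least $t>0$ for which some $g\in G_q$ satisfies $g\gamma(s)=\gamma(s+t)$ for all $s\in\mathbb R$, with $\gamma$ parametrized by hyperbolic arc length) is $$l(\gamma)=2\sum_{j=1}^n\ln|\xi_j|=-\ln\prod_{j=1}^n\bigl|[\overline{a_{j+1},\dots,a_n,a_1,\dots,a_j}]\bigr|^2 .$$ -/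

import Mathlib

open Filter Topology UpperHalfPlane OnePoint
open scoped MatrixGroups

noncomputable section

namespace Hecke

/-! ### The Hecke triangle group -/

/-- `λ_q = 2 cos (π / q)`. -/
def lam (q : ℕ) : ℝ := 2 * Real.cos (Real.pi / q)

/-- The matrix of `S : z ↦ -1 / z`. -/
def S : SL(2, ℝ) := ⟨!![0, -1; 1, 0], by simp [Matrix.det_fin_two]⟩

/-- The matrix of `T : z ↦ z + λ_q`. -/
def T (q : ℕ) : SL(2, ℝ) := ⟨!![1, lam q; 0, 1], by simp [Matrix.det_fin_two]⟩

/-- The Hecke triangle group `G_q`, as the group of matrices generated by `S` and `T`. It contains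
`-1 = S ^ 2`, so it is the full preimage in `SL(2, ℝ)` of the subgroup of `PSL(2, ℝ)`. -/
def group (q : ℕ) : Subgroup SL(2, ℝ) := Subgroup.closure {S, T q}

/-- The action of `SL(2, ℝ)` on the boundary `ℝ ∪ {∞}` by Möbius transformations. -/
def bdAct (g : SL(2, ℝ)) (x : OnePoint ℝ) : OnePoint ℝ := (g : GL (Fin 2) ℝ) • x

/-- The set `ℝ \ G_q(∞)` of `G_q`-irrational points. -/
def irrationalPoints (q : ℕ) : Set ℝ :=
  {x | ∀ g ∈ group q, bdAct g ∞ ≠ (x : OnePoint ℝ)}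

/-! ### `λ`-fractions -/

/-- The Möbius word `S T^{a₁} S T^{a₂} ⋯ S T^{aₙ}` of a finite sequence `[a₁, …, aₙ]`. -/
def word (q : ℕ) (l : List ℤ) : SL(2, ℝ) := (l.map fun c => S * T q ^ c).prod

/-- The point `S T^{a₁} ⋯ S T^{aₙ} (0)` of the finite `λ`-fraction `[0; a₁, …, aₙ]`. -/
def finitePoint (q : ℕ) (l : List ℤ) : OnePoint ℝ := bdAct (word q l) ((0 : ℝ) : OnePoint ℝ)

/-- The initial segment of length `N` of a sequence. -/
def initial (b : ℕ → ℤ) (N : ℕ) : List ℤ := (List.range N).map b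

/-- The infinite `λ`-fraction `[0; b 0, b 1, b 2, …]` converges to the real number `x`. -/
def ConvergesTo (q : ℕ) (b : ℕ → ℤ) (x : ℝ) : Prop :=
  Tendsto (fun N => finitePoint q (initial b N)) atTop (𝓝 (x : OnePoint ℝ))

/-! ### The regular `λ`-fraction of a real number -/

/-- The floor function with the symmetric convention: `n < x ≤ n + 1` for `x > 0` and
`n ≤ x < n + 1` for `x ≤ 0`. -/
def symFloor (x : ℝ) : ℤ := if 0 < x then ⌈x⌉ - 1 else ⌊x⌋

/-- The nearest `λ`-multiple `⌊x / λ + 1 / 2⌋`. -/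
def nearest (q : ℕ) (x : ℝ) : ℤ := symFloor (x / lam q + 1 / 2)

/-- The generating map `F_q`. -/
def F (q : ℕ) (x : ℝ) : ℝ := if x = 0 then 0 else -1 / x - nearest q (-1 / x) * lam q

/-- The points `x₁, x₂, …` of the regular continued fraction algorithm started at `x`:
`tail q x j` is `x_{j+1}`, where `x₁ = x - a₀ λ` and `x_{j+1} = F_q x_j`. -/
def tail (q : ℕ) (x : ℝ) (j : ℕ) : ℝ := (F q)^[j] (x - nearest q x * lam q)

/-- The regular `λ`-fraction `c_q(x)` is infinite and equal to `[a₀; a 0, a 1, a 2, …]`: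
the algorithm never reaches `0`, and its digits are the given ones. -/
def HasInfiniteCode (q : ℕ) (x : ℝ) (a₀ : ℤ) (a : ℕ → ℤ) : Prop :=
  nearest q x = a₀ ∧ ∀ j, tail q x j ≠ 0 ∧ nearest q (-1 / tail q x j) = a j

/-! ### The number `R` -/

/-- The number `h`. -/
def h (q : ℕ) : ℕ := if Even q then (q - 2) / 2 else (q - 3) / 2

/-- The forbidden blocks: for `q` even `(±1)^h, ±m` with `m ≥ 1`; for `q` odd `(±1)^{h+1}` and
`(±1)^h, ±2, (±1)^h, ±m` with `m ≥ 1` (the same sign throughout a block). -/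
def forbidden (q : ℕ) : Set (List ℤ) :=
  {B | ∃ e : ℤ, (e = 1 ∨ e = -1) ∧
    if Even q then
      ∃ m : ℤ, 1 ≤ m ∧ B = List.replicate (h q) e ++ [e * m]
    else
      B = List.replicate (h q + 1) e ∨
      ∃ m : ℤ, 1 ≤ m ∧
        B = List.replicate (h q) e ++ [e * 2] ++ List.replicate (h q) e ++ [e * m]}

/-- A finite sequence of non-zero integers in which no forbidden block, read in reversed order,
occurs as a block of consecutive entries. -/
def Admissible (q : ℕ) (l : List ℤ) : Prop :=
  (∀ c ∈ l, c ≠ 0) ∧ ∀ B ∈ forbidden q, ¬ B.reverse <:+: l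

/-- The values of the finite and infinite `λ`-fractions `[0; b₁, b₂, …]` without reversed forbidden
blocks. -/
def dualValues (q : ℕ) : Set ℝ :=
  {y | ∃ l : List ℤ, Admissible q l ∧ finitePoint q l = (y : OnePoint ℝ)} ∪
  {y | ∃ b : ℕ → ℤ, (∀ N, Admissible q (initial b N)) ∧ ConvergesTo q b y}

/-- `R` is the largest element of `dualValues q`. -/
def R (q : ℕ) : ℝ := sSup (dualValues q)

/-- `r = R - λ`. -/
def r (q : ℕ) : ℝ := R q - lam q

/-! ### The domain of the natural extension and strongly reduced geodesics -/

/-- `κ = h` for `q` even and `κ = 2 h + 1` for `q` odd. -/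
def kappa (q : ℕ) : ℕ := if Even q then h q else 2 * h q + 1

/-- The points `φ_0 < φ_1 < ⋯ < φ_κ = 0`, the orbit of `φ_0 = -λ / 2` under `F_q` in increasing
order: `φ_j = F_q^j φ_0` for `q` even, `φ_{2j} = F_q^j φ_0` and `φ_{2j-1} = F_q^{h+j} φ_0` for
`q` odd. -/
def phi (q j : ℕ) : ℝ :=
  if Even q then (F q)^[j] (-(lam q) / 2)
  else if Even j then (F q)^[j / 2] (-(lam q) / 2)
  else (F q)^[h q + (j + 1) / 2] (-(lam q) / 2)

/-- The points `r_1 > r_2 > ⋯ > r_κ = r`. For `q` even `r = [(1^{h-1}, 2)^∞]` and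
`r_j = [1^{j-1}, 2, …] = F_q^{h-j} r`; for `q` odd `r = [(1^h, 2, 1^{h-1}, 2)^∞]`,
`r_{2j+1} = [1^j, 2, 1^{h-1}, 2, …] = F_q^{h-j} r` and
`r_{2j} = [1^{j-1}, 2, 1^h, 2, …] = F_q^{2h+1-j} r`. -/
def rPoint (q j : ℕ) : ℝ :=
  if Even q then (F q)^[h q - j] (r q)
  else if Even j then (F q)^[2 * h q + 1 - j / 2] (r q)
  else (F q)^[h q - j / 2] (r q)

/-- The union of the rectangles `Ω_j = [φ_{j-1}, φ_j) × [r_j, R]` with `1 ≤ j ≤ κ`. -/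
def OmegaPos (q : ℕ) : Set (ℝ × ℝ) :=
  {p | ∃ j, 1 ≤ j ∧ j ≤ kappa q ∧
    p.1 ∈ Set.Ico (phi q (j - 1)) (phi q j) ∧ p.2 ∈ Set.Icc (rPoint q j) (R q)}

/-- The domain `Ω = ⋃ Ω_j`, `1 ≤ |j| ≤ κ`, where `Ω_{-j} = -Ω_j`. -/
def Omega (q : ℕ) : Set (ℝ × ℝ) := {p | p ∈ OmegaPos q ∨ -p ∈ OmegaPos q}

/-- The domain `Ω*` of the pairs `(ξ, η)` of `G_q`-irrational numbers with
`(S ξ, -η) = (-1 / ξ, -η) ∈ Ω`. (As `0` is not `G_q`-irrational, `ξ ≠ 0` for such a pair.) -/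
def OmegaStar (q : ℕ) : Set (ℝ × ℝ) :=
  {p | -1 / p.1 ∈ irrationalPoints q ∧ -p.2 ∈ irrationalPoints q ∧ (-1 / p.1, -p.2) ∈ Omega q}

/-- The geodesic from `η` to `ξ` is strongly reduced: `(ξ, η) ∈ Ω*`, and `|ξ| > 3 λ / 2` or
`ξ η < 0`. Of two `G_q`-equivalent geodesics of this kind with `η` equivalent to `±r` one is
often discarded, in order to have unique representatives; here both are kept. -/
def IsStronglyReduced (q : ℕ) (ξ η : ℝ) : Prop :=
  (ξ, η) ∈ OmegaStar q ∧ (3 * lam q / 2 < |ξ| ∨ ξ * η < 0)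

/-! ### Geodesics and their lengths -/

/-- The geodesic `γ(ξ, η)` of the upper half-plane from `η` to `ξ`, parametrized by hyperbolic arc
length, with `γ 0` the highest point of the half-circle. -/
def geodesic (ξ η : ℝ) (hne : ξ ≠ η) (s : ℝ) : ℍ :=
  UpperHalfPlane.mk
    (⟨(ξ + η) / 2 + (ξ - η) / 2 * Real.tanh s, |ξ - η| / 2 / Real.cosh s⟩ : ℂ)
    (div_pos (half_pos (abs_pos.mpr (sub_ne_zero.mpr hne))) (Real.cosh_pos s))

/-- The `t > 0` after which the projection of `γ(ξ, η)` to `G_q \ ℍ`, run with unit speed, has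
returned to its start and repeats itself. -/
def periods (q : ℕ) (ξ η : ℝ) (hne : ξ ≠ η) : Set ℝ :=
  {t | 0 < t ∧ ∃ g ∈ group q, ∀ s, g • geodesic ξ η hne s = geodesic ξ η hne (s + t)}

/-- The projection of `γ(ξ, η)` to `G_q \ ℍ` is a closed geodesic. -/
def IsClosedGeodesic (q : ℕ) (ξ η : ℝ) (hne : ξ ≠ η) : Prop := (periods q ξ η hne).Nonempty

/-- `l` is the hyperbolic length of the closed geodesic on `G_q \ ℍ` given by `γ(ξ, η)`, that is,
the length of one full traversal: the least period of its unit speed parametrization. -/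
def IsLength (q : ℕ) (ξ η : ℝ) (hne : ξ ≠ η) (l : ℝ) : Prop := IsLeast (periods q ξ η hne) l

/-- `ξ_j = S F_q^j S ξ`. -/
def xi (q : ℕ) (ξ : ℝ) (j : ℕ) : ℝ := -1 / (F q)^[j] (-1 / ξ)

end Hecke

end

/-! Put `t_j = F_q^j(Sξ)` and let `w_j` be the word of the first `j` digits, so that `w_j` maps
`t_j` to `t_0 = Sξ` with automorphy factor `∏_{i<j} (-1/t_i)`. Since `|t_j| ≤ λ/2 < 1`, the
expansion converges and its remainders inherit the period `n` of the digits. The word `W = w_n`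
therefore fixes `Sξ` with eigenvalue `ω`, where `ω² = ∏ ξ_j² = exp ℓ` and `ℓ` is the claimed length.

An element of `G_q` translates the geodesic by `t` exactly when both end points are eigendirections
with eigenvalues `k`, `1/k` and `k² = exp t` (`smul_geodesic_iff`). Thus everything rests on showing
that the stabilizer of `Sξ` is generated up to sign by `W` (`eq_zpow_word`). Every period is then a
multiple of `ℓ`. As the geodesic is closed, some hyperbolic `±W^k`, conjugated by `S`, fixes `η`
too, hence so does the conjugate of `W`, and `ℓ` itself is a period.

The stabilizer is found geometrically. The points `w_j(∞)` form a path of edges, images of the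
geodesic from `0` to `∞`, that ends at `Sξ`. If `g` fixes `Sξ`, the image path has the same end
point, and edges never cross (`prod_entries_nonneg`), so the two paths share a vertex
(`exists_common_vertex`). Then `w_j⁻¹ g w_i` fixes `∞`, so it is `±T^k`, and `t_j = t_i + kλ`.
Because `±λ/2` are cusps and `Sξ` is not, both remainders lie strictly inside `(-λ/2, λ/2)`. Hence
`k = 0` and `g = ±w_j w_i⁻¹`, a power of `W` up to sign. -/

namespace Hecke

/-! ### Entries of the elements of the Hecke group -/

/-- The elliptic generator `T S : z ↦ λ - 1 / z` of order `q`. -/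
noncomputable def U (q : ℕ) : SL(2, ℝ) := T q * S

lemma coe_S : (S : Matrix (Fin 2) (Fin 2) ℝ) = !![0, -1; 1, 0] := rfl

lemma coe_T (q : ℕ) : (T q : Matrix (Fin 2) (Fin 2) ℝ) = !![1, lam q; 0, 1] := rfl

lemma S_mul_S : S * S = -1 := by
  ext i j
  fin_cases i <;> fin_cases j <;> simp [coe_S]

lemma S_inv : S⁻¹ = -S := by
  rw [inv_eq_iff_mul_eq_one, mul_neg, S_mul_S, neg_neg]

lemma S_mem (q : ℕ) : S ∈ group q := Subgroup.subset_closure (by simp)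

lemma T_mem (q : ℕ) : T q ∈ group q := Subgroup.subset_closure (by simp)

lemma U_mem (q : ℕ) : U q ∈ group q := mul_mem (T_mem q) (S_mem q)

lemma neg_mem_group {q : ℕ} {g : SL(2, ℝ)} (hg : g ∈ group q) : -g ∈ group q := by
  have := mul_mem (mul_mem (S_mem q) (S_mem q)) hg
  rwa [S_mul_S, neg_one_mul] at this

lemma angle_bounds {q : ℕ} (hq : 3 ≤ q) : 0 < Real.pi / q ∧ Real.pi / q ≤ Real.pi / 3 := by
  have h3 : (3 : ℝ) ≤ q := by exact_mod_cast hq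
  have := Real.pi_pos
  exact ⟨by positivity, by gcongr⟩

lemma sin_angle_pos {q : ℕ} (hq : 3 ≤ q) : 0 < Real.sin (Real.pi / q) := by
  have := angle_bounds hq
  exact Real.sin_pos_of_pos_of_lt_pi this.1 (by linarith [Real.pi_pos])

lemma lam_bounds {q : ℕ} (hq : 3 ≤ q) : 1 ≤ lam q ∧ lam q < 2 := by
  have hb := angle_bounds hq
  have hpi := Real.pi_pos
  constructor
  · have := Real.cos_le_cos_of_nonneg_of_le_pi hb.1.le (by linarith) hb.2
    rw [Real.cos_pi_div_three] at this
    unfold lam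
    linarith
  · have := Real.cos_lt_cos_of_nonneg_of_le_pi (le_refl 0) (by linarith) hb.1
    rw [Real.cos_zero] at this
    unfold lam
    linarith

lemma lam_pos {q : ℕ} (hq : 3 ≤ q) : 0 < lam q := by linarith [(lam_bounds hq).1]

lemma U_pow_eq {q : ℕ} (hq : 3 ≤ q) (i : ℕ) :
    ((U q ^ i : SL(2, ℝ)) : Matrix (Fin 2) (Fin 2) ℝ) =
      !![Real.sin ((i + 1) * (Real.pi / q)) / Real.sin (Real.pi / q),
          -(Real.sin (i * (Real.pi / q)) / Real.sin (Real.pi / q));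
        Real.sin (i * (Real.pi / q)) / Real.sin (Real.pi / q),
          -(Real.sin ((i - 1) * (Real.pi / q)) / Real.sin (Real.pi / q))] := by
  have hs := (sin_angle_pos hq).ne'
  have hU : (U q : Matrix (Fin 2) (Fin 2) ℝ) = !![lam q, -1; 1, 0] := by
    ext i j
    fin_cases i <;> fin_cases j <;> simp [U, coe_T, coe_S]
  -- The Chebyshev recursion: multiplying by `U` shifts the index of the sine quotients by one.
  have key : ∀ x : ℝ, lam q * Real.sin (x * (Real.pi / q)) =
      Real.sin ((x + 1) * (Real.pi / q)) + Real.sin ((x - 1) * (Real.pi / q)) := by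
    intro x
    rw [add_mul, sub_mul, one_mul, Real.sin_add, Real.sin_sub, lam]
    ring
  induction i with
  | zero =>
    ext i j
    fin_cases i <;> fin_cases j <;> simp [hs]
  | succ k ih =>
    rw [pow_succ, Matrix.SpecialLinearGroup.coe_mul, ih, hU]
    have h1 := key (k + 1)
    have h2 := key k
    have e : (k : ℝ) + 1 - 1 = k := by ring
    rw [e] at h1
    push_cast
    rw [e]
    generalize Real.sin ((k + 1 + 1) * (Real.pi / q)) = s₂ at *
    generalize Real.sin ((k + 1) * (Real.pi / q)) = s₁ at *
    generalize Real.sin (k * (Real.pi / q)) = s₀ at *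
    generalize Real.sin ((k - 1) * (Real.pi / q)) = s₃ at *
    ext i j
    fin_cases i <;> fin_cases j <;> simp
    · field_simp
      linarith
    · field_simp
      linarith

lemma U_pow_q {q : ℕ} (hq : 3 ≤ q) : U q ^ q = -1 := by
  have hs := (sin_angle_pos hq).ne'
  have hq0 : (q : ℝ) ≠ 0 := by positivity
  have e : (q : ℝ) * (Real.pi / q) = Real.pi := by field_simp
  ext i j
  rw [U_pow_eq hq, add_mul, sub_mul, e, one_mul]
  have h1 : Real.sin (Real.pi + Real.pi / q) = -Real.sin (Real.pi / q) := by
    rw [add_comm, Real.sin_add_pi]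
  fin_cases i <;> fin_cases j <;> simp [h1, hs, Real.sin_pi_sub]

lemma sin_ratio {q : ℕ} (hq : 3 ≤ q) {k : ℝ} (hk : 1 ≤ k) (hkq : k ≤ q - 1) :
    1 ≤ Real.sin (k * (Real.pi / q)) / Real.sin (Real.pi / q) := by
  have hb := angle_bounds hq
  have hpi := Real.pi_pos
  have hq0 : (q : ℝ) ≠ 0 := by positivity
  have e : (q : ℝ) * (Real.pi / q) = Real.pi := by field_simp
  rw [one_le_div (sin_angle_pos hq)]
  have h1 : Real.pi / q ≤ k * (Real.pi / q) := by nlinarith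
  have h2 : k * (Real.pi / q) ≤ Real.pi - Real.pi / q := by nlinarith
  rcases le_total (k * (Real.pi / q)) (Real.pi / 2) with h3 | h3
  · exact Real.sin_le_sin_of_le_of_le_pi_div_two (by linarith) h3 h1
  · rw [← Real.sin_pi_sub (k * (Real.pi / q))]
    exact Real.sin_le_sin_of_le_of_le_pi_div_two (by linarith) (by linarith) (by linarith)

/-- Either zero or at least one. -/
def ZeroOrLarge (x : ℝ) : Prop := x = 0 ∨ 1 ≤ x

lemma ZeroOrLarge.nonneg {x : ℝ} (hx : ZeroOrLarge x) : 0 ≤ x := by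
  rcases hx with hx | hx <;> linarith

lemma ZeroOrLarge.add {x y : ℝ} (hx : ZeroOrLarge x) (hy : ZeroOrLarge y) :
    ZeroOrLarge (x + y) := by
  rcases hx with rfl | hx
  · simpa using hy
  · exact Or.inr (by linarith [hy.nonneg])

lemma ZeroOrLarge.mul {x y : ℝ} (hx : ZeroOrLarge x) (hy : ZeroOrLarge y) :
    ZeroOrLarge (x * y) := by
  rcases hx with rfl | hx
  · exact Or.inl (zero_mul y)
  · rcases hy with rfl | hy
    · exact Or.inl (mul_zero x)
    · exact Or.inr (by nlinarith)

/-- The entries are `sin(kπ/q) / sin(π/q)` with `k ∈ {i-1, i, i+1}`, so `0 ≤ k ≤ q`: the quotient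
vanishes at the two extremes and is at least `1` in between. -/
lemma zeroOrLarge_U_pow_mul_S_inv {q : ℕ} (hq : 3 ≤ q) {i : ℕ} (hi : 1 ≤ i) (hiq : i < q)
    (k l : Fin 2) : ZeroOrLarge ((U q ^ i * S⁻¹ : SL(2, ℝ)) k l) := by
  have hs := (sin_angle_pos hq).ne'
  have hq0 : (q : ℝ) ≠ 0 := by positivity
  have e : (q : ℝ) * (Real.pi / q) = Real.pi := by field_simp
  have h1 : (1 : ℝ) ≤ i := by exact_mod_cast hi
  have h2 : (i : ℝ) ≤ q - 1 := by
    have : (i : ℝ) + 1 ≤ q := by exact_mod_cast hiq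
    linarith
  have hd : ZeroOrLarge (Real.sin (i * (Real.pi / q)) / Real.sin (Real.pi / q)) :=
    Or.inr (sin_ratio hq h1 h2)
  have hu : ZeroOrLarge (Real.sin ((i + 1) * (Real.pi / q)) / Real.sin (Real.pi / q)) := by
    rcases Nat.lt_or_ge (i + 1) q with h | h
    · have : (i : ℝ) + 1 + 1 ≤ q := by exact_mod_cast h
      exact Or.inr (sin_ratio hq (by linarith) (by linarith))
    · have : (i : ℝ) + 1 = q := by exact_mod_cast le_antisymm hiq h
      left
      rw [this, e]
      simp
  have hl : ZeroOrLarge (Real.sin ((i - 1) * (Real.pi / q)) / Real.sin (Real.pi / q)) := by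
    rcases Nat.lt_or_ge 1 i with h | h
    · have : (1 : ℝ) + 1 ≤ i := by exact_mod_cast h
      exact Or.inr (sin_ratio hq (by linarith) (by linarith))
    · have : (i : ℝ) = 1 := by exact_mod_cast le_antisymm h hi
      left
      simp [this]
  rw [S_inv, Matrix.SpecialLinearGroup.coe_mul, U_pow_eq hq, Matrix.SpecialLinearGroup.coe_neg,
    coe_S]
  fin_cases k <;> fin_cases l <;> simpa

/-- Products of the matrices `U ^ i S⁻¹`, `1 ≤ i < q`, followed by a power of `S`. -/
inductive IsReducedWord (q : ℕ) : SL(2, ℝ) → Prop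
  | one : IsReducedWord q 1
  | S : IsReducedWord q S
  | neg {g : SL(2, ℝ)} : IsReducedWord q g → IsReducedWord q (-g)
  | step {g : SL(2, ℝ)} (i : ℕ) (hi : 1 ≤ i) (hiq : i < q) :
      IsReducedWord q g → IsReducedWord q (U q ^ i * S⁻¹ * g)

/-- A reduced word, possibly preceded by `S`. -/
def IsNormalForm (q : ℕ) (g : SL(2, ℝ)) : Prop := IsReducedWord q g ∨ IsReducedWord q (S * g)

lemma IsNormalForm.neg {q : ℕ} {g : SL(2, ℝ)} (hg : IsNormalForm q g) : IsNormalForm q (-g) := by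
  rcases hg with hg | hg
  · exact Or.inl hg.neg
  · exact Or.inr (by rw [mul_neg]; exact hg.neg)

lemma IsNormalForm.S_mul {q : ℕ} {g : SL(2, ℝ)} (hg : IsNormalForm q g) :
    IsNormalForm q (Hecke.S * g) := by
  rcases hg with hg | hg
  · exact Or.inr (by rw [← mul_assoc, S_mul_S, neg_one_mul]; exact hg.neg)
  · exact Or.inl hg

/-- The leading exponent rises by one. When it reaches `q`, the relation `U ^ q = -1` removes the
syllable and leaves a leading `S`. -/
lemma IsReducedWord.U_mul {q : ℕ} (hq : 3 ≤ q) {g : SL(2, ℝ)} (hg : IsReducedWord q g) :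
    IsNormalForm q (U q * g) := by
  induction hg with
  | one =>
    left
    simpa using IsReducedWord.step 1 le_rfl (by omega) (IsReducedWord.S (q := q))
  | S =>
    left
    have := IsReducedWord.step 1 le_rfl (by omega) (IsReducedWord.one (q := q)).neg
    simpa [S_inv] using this
  | neg _ ih =>
    rw [mul_neg]
    exact ih.neg
  | @step g i hi hiq hg ih =>
    have e : U q * (U q ^ i * Hecke.S⁻¹ * g) = U q ^ (i + 1) * Hecke.S⁻¹ * g := by
      rw [pow_succ']
      simp only [mul_assoc]
    rw [e]
    rcases Nat.lt_or_ge (i + 1) q with h | h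
    · exact Or.inl (hg.step _ (by omega) h)
    · right
      rw [le_antisymm hiq h, U_pow_q hq, S_inv]
      simpa [← mul_assoc, S_mul_S] using hg.neg

lemma IsNormalForm.U_mul {q : ℕ} (hq : 3 ≤ q) {g : SL(2, ℝ)} (hg : IsNormalForm q g) :
    IsNormalForm q (U q * g) := by
  rcases hg with hg | hg
  · exact hg.U_mul hq
  · left
    simpa using hg.step 1 le_rfl (by omega)

lemma isNormalForm_of_mem {q : ℕ} (hq : 3 ≤ q) {g : SL(2, ℝ)} (hg : g ∈ group q) :
    IsNormalForm q g := by
  have hpow : ∀ (k : ℕ) (g : SL(2, ℝ)), IsNormalForm q g → IsNormalForm q (U q ^ k * g) := by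
    intro k
    induction k with
    | zero => simp
    | succ k ih =>
      intro g hg
      rw [pow_succ', mul_assoc]
      exact (ih g hg).U_mul hq
  have hT : T q = -(U q * S) := by
    rw [U, mul_assoc, S_mul_S, mul_neg_one, neg_neg]
  have hUinv : (U q)⁻¹ = -U q ^ (q - 1) := by
    rw [inv_eq_iff_mul_eq_one, mul_neg, ← pow_succ', Nat.sub_add_cancel (by omega), U_pow_q hq,
      neg_neg]
  have hTinv : (T q)⁻¹ = -(S * U q ^ (q - 1)) := by
    have : T q = U q * S⁻¹ := by rw [U, mul_inv_cancel_right]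
    rw [this, mul_inv_rev, inv_inv, hUinv, mul_neg]
  induction hg using Subgroup.closure_induction_left with
  | one => exact Or.inl .one
  | mul_left x hx y _ ih =>
    rcases hx with rfl | rfl
    · exact ih.S_mul
    · rw [hT, neg_mul, mul_assoc]
      exact (ih.S_mul.U_mul hq).neg
  | inv_mul_cancel x hx y _ ih =>
    rcases hx with rfl | rfl
    · rw [S_inv, neg_mul]
      exact ih.S_mul.neg
    · rw [hTinv, neg_mul, mul_assoc]
      exact (hpow _ _ ih).S_mul.neg

/-- The syllables have entries that are zero or at least `1`, so multiplying by them on the left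
keeps the sign of each column and the gap between `0` and `1`. The sign depends on the column
because of a possible final `S`. -/
lemma IsReducedWord.entries {q : ℕ} (hq : 3 ≤ q) {g : SL(2, ℝ)} (hg : IsReducedWord q g) :
    ∀ l : Fin 2, ∃ e : ℝ, (e = 1 ∨ e = -1) ∧ ∀ k, ZeroOrLarge (e * g k l) := by
  induction hg with
  | one =>
    intro l
    refine ⟨1, Or.inl rfl, fun k => ?_⟩
    fin_cases k <;> fin_cases l <;> simp [ZeroOrLarge]
  | S =>
    intro l
    fin_cases l
    · refine ⟨1, Or.inl rfl, fun k => ?_⟩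
      fin_cases k <;> simp [ZeroOrLarge, Hecke.S]
    · refine ⟨-1, Or.inr rfl, fun k => ?_⟩
      fin_cases k <;> simp [ZeroOrLarge, Hecke.S]
  | neg _ ih =>
    intro l
    obtain ⟨e, he, hk⟩ := ih l
    refine ⟨-e, ?_, fun k => by simpa using hk k⟩
    rcases he with rfl | rfl <;> simp
  | step i hi hiq hg ih =>
    intro l
    obtain ⟨e, he, hk⟩ := ih l
    refine ⟨e, he, fun k => ?_⟩
    have hA := zeroOrLarge_U_pow_mul_S_inv hq hi hiq k
    rw [Matrix.SpecialLinearGroup.coe_mul, Matrix.mul_apply, Fin.sum_univ_two, mul_add,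
      mul_left_comm, mul_left_comm e]
    exact ((hA 0).mul (hk 0)).add ((hA 1).mul (hk 1))

lemma IsReducedWord.entry_eq_zero_or {q : ℕ} (hq : 3 ≤ q) {g : SL(2, ℝ)} (hg : IsReducedWord q g)
    (k l : Fin 2) : g k l = 0 ∨ 1 ≤ |g k l| := by
  obtain ⟨e, he, hk⟩ := hg.entries hq l
  have hk := hk k
  rcases he with rfl | rfl <;> rcases hk with hk | hk
  · left; linarith
  · right; exact le_abs.2 (Or.inl (by linarith))
  · left; linarith
  · right; exact le_abs.2 (Or.inr (by linarith))

lemma IsReducedWord.prod_entries_nonneg {q : ℕ} (hq : 3 ≤ q) {g : SL(2, ℝ)}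
    (hg : IsReducedWord q g) : 0 ≤ g 0 0 * g 1 0 * (g 0 1 * g 1 1) := by
  have key : ∀ l : Fin 2, 0 ≤ g 0 l * g 1 l := by
    intro l
    obtain ⟨e, he, hk⟩ := hg.entries hq l
    have := mul_nonneg (hk 0).nonneg (hk 1).nonneg
    rcases he with rfl | rfl <;> linarith
  exact mul_nonneg (key 0) (key 1)

lemma S_mul_apply (g : SL(2, ℝ)) (l : Fin 2) :
    (S * g) 0 l = -g 1 l ∧ (S * g) 1 l = g 0 l := by
  constructor <;> simp [coe_S, Matrix.mul_apply]

/-- This quantitative discreteness of `G_q` replaces integrality of the entries in all later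
arguments. -/
lemma entry_eq_zero_or {q : ℕ} (hq : 3 ≤ q) {g : SL(2, ℝ)} (hg : g ∈ group q) (k l : Fin 2) :
    g k l = 0 ∨ 1 ≤ |g k l| := by
  rcases isNormalForm_of_mem hq hg with h | h
  · exact h.entry_eq_zero_or hq k l
  · have h0 := h.entry_eq_zero_or hq 0 l
    have h1 := h.entry_eq_zero_or hq 1 l
    rw [(S_mul_apply g l).1, abs_neg, neg_eq_zero] at h0
    rw [(S_mul_apply g l).2] at h1
    fin_cases k
    · exact h1
    · exact h0

/-- The image of the geodesic from `0` to `∞` under the Hecke group does not cross it. -/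
lemma prod_entries_nonneg {q : ℕ} (hq : 3 ≤ q) {g : SL(2, ℝ)} (hg : g ∈ group q) :
    0 ≤ g 0 0 * g 1 0 * (g 0 1 * g 1 1) := by
  rcases isNormalForm_of_mem hq hg with h | h
  · exact h.prod_entries_nonneg hq
  · have := h.prod_entries_nonneg hq
    simp only [S_mul_apply] at this
    linarith

/-! ### The stabilizer of `∞` and the cusps `±λ/2`. -/

lemma T_zpow_eq (q : ℕ) (k : ℤ) :
    ((T q ^ k : SL(2, ℝ)) : Matrix (Fin 2) (Fin 2) ℝ) = !![1, k * lam q; 0, 1] := by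
  induction k using Int.induction_on with
  | zero =>
    ext i j
    fin_cases i <;> fin_cases j <;> simp
  | succ k ih =>
    rw [zpow_add_one, Matrix.SpecialLinearGroup.coe_mul, ih]
    ext i j
    fin_cases i <;> fin_cases j <;> simp [coe_T]
    ring
  | pred k ih =>
    rw [zpow_sub_one, Matrix.SpecialLinearGroup.coe_mul, ih]
    ext i j
    fin_cases i <;> fin_cases j <;>
      simp [coe_T, Matrix.SpecialLinearGroup.coe_inv, Matrix.adjugate_fin_two]
    ring

/-- The stabilizer of `∞` consists of the matrices `± T ^ k`. -/
lemma eq_T_zpow_of_apply_eq_zero {q : ℕ} (hq : 3 ≤ q) {g : SL(2, ℝ)} (hg : g ∈ group q)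
    (hc : g 1 0 = 0) : ∃ k : ℤ, g = T q ^ k ∨ g = -T q ^ k := by
  have hl := lam_bounds hq
  have hdet : g 0 0 * g 1 1 = 1 := by
    have := g.det_coe
    rw [Matrix.det_fin_two, hc] at this
    linarith
  have h00 : 1 ≤ |g 0 0| := (entry_eq_zero_or hq hg 0 0).resolve_left (by rintro h; simp [h] at hdet)
  have h11 : 1 ≤ |g 1 1| := (entry_eq_zero_or hq hg 1 1).resolve_left (by rintro h; simp [h] at hdet)
  have habs : |g 0 0| * |g 1 1| = 1 := by rw [← abs_mul, hdet, abs_one]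
  have ha : |g 0 0| = 1 := by nlinarith
  have main : ∀ g ∈ group q, g 1 0 = 0 → g 0 0 = 1 → g 1 1 = 1 → ∃ k : ℤ, g = T q ^ k := by
    intro g hg h10 h00 h11
    -- Rounding leaves an error of at most `λ/2 < 1`, and the gap for entries then forces the error
    -- to be `0`.
    obtain ⟨k, hk⟩ : ∃ k : ℤ, |g 0 1 - k * lam q| < 1 := by
      refine ⟨round (g 0 1 / lam q), ?_⟩
      have := abs_sub_round (g 0 1 / lam q)
      have e : g 0 1 - round (g 0 1 / lam q) * lam q =
          (g 0 1 / lam q - round (g 0 1 / lam q)) * lam q := by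
        have : lam q ≠ 0 := by linarith
        field_simp
      rw [e, abs_mul, abs_of_pos (lam_pos hq)]
      nlinarith
    refine ⟨k, ?_⟩
    have hmem : T q ^ (-k) * g ∈ group q := mul_mem (zpow_mem (T_mem q) _) hg
    have hent : (T q ^ (-k) * g : SL(2, ℝ)) 0 1 = g 0 1 - k * lam q := by
      rw [Matrix.SpecialLinearGroup.coe_mul, Matrix.mul_apply, T_zpow_eq]
      simp [h11]
      ring
    have h0 := entry_eq_zero_or hq hmem 0 1
    rw [hent] at h0
    have h0 := h0.resolve_right (not_le.2 hk)
    ext i j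
    rw [T_zpow_eq]
    fin_cases i <;> fin_cases j <;> simp [h10, h00, h11]
    linarith
  rcases (abs_eq (zero_le_one)).1 ha with h | h
  · obtain ⟨k, hk⟩ := main g hg hc h (by rw [h] at hdet; linarith)
    exact ⟨k, Or.inl hk⟩
  · obtain ⟨k, hk⟩ := main (-g) (neg_mem_group hg) (by simp [hc]) (by simp [h])
      (by rw [h] at hdet; simp; linarith)
    exact ⟨k, Or.inr (by rw [← hk, neg_neg])⟩

/-- The points `± λ / 2` are cusps. -/
lemma half_lam_cusp {q : ℕ} (hq : 3 ≤ q) :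
    ∃ g ∈ group q, g 1 0 ≠ 0 ∧ g 0 0 = lam q / 2 * g 1 0 := by
  have hs := sin_angle_pos hq
  have hq0 : (q : ℝ) ≠ 0 := by positivity
  rcases Nat.even_or_odd' q with ⟨m, hm | hm⟩
  · have e : (m : ℝ) * (Real.pi / q) = Real.pi / 2 := by
      have : (q : ℝ) = 2 * m := by exact_mod_cast hm
      have : (m : ℝ) ≠ 0 := by rintro h; apply hq0; rw [this, h]; simp
      rw [show (q : ℝ) = 2 * m by exact_mod_cast hm]
      field_simp
    -- For `q = 2m`, `U^m(∞) = sin((m+1)π/q) / sin(mπ/q) = cos(π/q)`.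
    refine ⟨U q ^ m, pow_mem (U_mem q) m, ?_, ?_⟩ <;> rw [U_pow_eq hq] <;>
      simp only [add_mul, e, one_mul] <;> simp [Real.sin_add, hs.ne', lam]
    field_simp
  · have hq' : (q : ℝ) = 2 * m + 1 := by exact_mod_cast hm
    have e : (m : ℝ) * (Real.pi / q) = Real.pi / 2 - Real.pi / q / 2 := by
      rw [hq'] at hq0 ⊢
      field_simp
      ring
    have hsin : Real.sin (m * (Real.pi / q)) = Real.cos (Real.pi / q / 2) := by
      rw [e, Real.sin_pi_div_two_sub]
    have hsin1 : Real.sin ((m + 1) * (Real.pi / q)) = Real.cos (Real.pi / q / 2) := by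
      rw [add_mul, e, ← Real.sin_pi_div_two_sub, ← Real.sin_pi_sub]
      congr 1
      ring
    have hsin2 : Real.sin ((m - 1) * (Real.pi / q)) =
        Real.cos (Real.pi / q / 2) * (lam q - 1) := by
      have : (m - 1) * (Real.pi / q) = Real.pi / 2 - 3 * (Real.pi / q / 2) := by
        rw [sub_mul, e]
        ring
      rw [this, Real.sin_pi_div_two_sub, Real.cos_three_mul, lam,
        show Real.pi / q = 2 * (Real.pi / q / 2) by ring, Real.cos_two_mul]
      ring_nf
    have hc : 0 < Real.cos (Real.pi / q / 2) := by
      have := angle_bounds hq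
      exact Real.cos_pos_of_mem_Ioo ⟨by linarith [Real.pi_pos], by linarith [Real.pi_pos]⟩
    have hl := lam_bounds hq
    have hU := U_pow_eq hq m
    rw [hsin, hsin1, hsin2] at hU
    set σ := Real.cos (Real.pi / q / 2) / Real.sin (Real.pi / q) with hσ
    have hσ0 : 0 < σ := div_pos hc hs
    rw [mul_div_right_comm, ← hσ] at hU
    -- For `q = 2m + 1`, the path of `∞` is `U^m(∞) = 1`, `T(1) = 1 + λ`, `U^m(1 + λ) = λ/2`.
    refine ⟨U q ^ m * T q * U q ^ m,
      mul_mem (mul_mem (pow_mem (U_mem q) m) (T_mem q)) (pow_mem (U_mem q) m), ?_, ?_⟩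
    · simp [Matrix.mul_apply, hU, coe_T]
      nlinarith [mul_pos hσ0 hσ0]
    · simp [Matrix.mul_apply, hU, coe_T]
      ring

/-! ### Non-crossing paths with a common end point -/

lemma mul_pos_of_forall_mul_succ_pos {u : ℕ → ℝ} (hu : ∀ k, 0 < u k * u (k + 1)) (m k : ℕ) :
    0 < u m * u (m + k) := by
  induction k with
  | zero =>
    have : u m ≠ 0 := left_ne_zero_of_mul (hu m).ne'
    exact mul_self_pos.2 this
  | succ k ih =>
    have h1 := mul_pos ih (hu (m + k))
    have h2 : 0 < u (m + k) ^ 2 := by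
      have : u (m + k) ≠ 0 := left_ne_zero_of_mul (hu (m + k)).ne'
      positivity
    have h3 : u m * u (m + k) * (u (m + k) * u (m + k + 1)) =
        u m * u (m + (k + 1)) * u (m + k) ^ 2 := by
      rw [← add_assoc]
      ring
    rw [h3] at h1
    exact pos_of_mul_pos_left h1 h2.le

lemma mul_limit_pos {u : ℕ → ℝ} {l : ℝ} (hu : ∀ k, 0 < u k * u (k + 1))
    (hl : Tendsto u atTop (𝓝 l)) (hl0 : l ≠ 0) (m : ℕ) : 0 < u m * l := by
  have h1 : Tendsto (fun k => u m * u (m + k)) atTop (𝓝 (u m * l)) := by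
    have : Tendsto (fun k => u (k + m)) atTop (𝓝 l) := (tendsto_add_atTop_iff_nat m).2 hl
    simp_rw [add_comm m]
    exact this.const_mul _
  have h2 : 0 ≤ u m * l :=
    ge_of_tendsto' h1 fun k => (mul_pos_of_forall_mul_succ_pos hu m k).le
  exact lt_of_le_of_ne h2 (mul_ne_zero (left_ne_zero_of_mul (hu m).ne') hl0).symm

/-- Two sequences of points with the same limit `x`, lying on the same sides of `x`, such that no
half-circle over two consecutive points of the first crosses one of the second, have a common
point. -/
lemma exists_eq_of_noncrossing {v v' : ℕ → ℝ} {x : ℝ} (hv : Tendsto v atTop (𝓝 x))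
    (hv' : Tendsto v' atTop (𝓝 x)) (hsgn : ∀ i, 0 < (v' i - x) * (v i - x))
    (hnc : ∀ i j, 0 ≤ (v' i - v (j + 1)) * (v' (i + 1) - v (j + 1)) *
      ((v j - v' i) * (v j - v' (i + 1)))) : ∃ i j, v j = v' i := by
  by_contra! hd
  have hne : ∀ j, v j - x ≠ 0 := fun j => right_ne_zero_of_mul (hsgn j).ne'
  have hne' : ∀ j, v' j - x ≠ 0 := fun j => left_ne_zero_of_mul (hsgn j).ne'
  -- Without common points, the second path never crosses the edge from `v j` to `v (j + 1)`; as it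
  -- tends to `x`, all of it lies on the same side of that edge as `x`.
  have side : ∀ i j, 0 < ((v' i - v (j + 1)) * (v' i - v j)) * ((x - v (j + 1)) * (x - v j)) := by
    intro i j
    refine mul_limit_pos (u := fun i => (v' i - v (j + 1)) * (v' i - v j)) (fun k => ?_)
      ((hv'.sub_const _).mul (hv'.sub_const _)) ?_ i
    · have h0 : (v' k - v (j + 1)) * (v' (k + 1) - v (j + 1)) *
          ((v j - v' k) * (v j - v' (k + 1))) ≠ 0 := by
        refine mul_ne_zero (mul_ne_zero ?_ ?_) (mul_ne_zero ?_ ?_) <;>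
          exact sub_ne_zero.2 (by first | exact (hd _ _).symm | exact hd _ _)
      have := lt_of_le_of_ne (hnc k j) h0.symm
      linarith
    · have h1 := hne (j + 1)
      have h2 := hne j
      exact mul_ne_zero (by rwa [← neg_sub, neg_ne_zero]) (by rwa [← neg_sub, neg_ne_zero])
  -- If the first path jumps over `x` infinitely often, an edge straddling `x` closely enough
  -- separates `x` from `v' 0`. Otherwise its tail stays on one side of `x`.
  by_cases hB : ∃ᶠ j in atTop, (v j - x) * (v (j + 1) - x) < 0
  · have hclose : ∀ᶠ j in atTop, |v j - x| < |v' 0 - x| := by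
      have := (hv.sub_const x).abs
      rw [sub_self, abs_zero] at this
      exact this.eventually_lt_const (abs_pos.2 (hne' 0))
    have hclose1 := (tendsto_add_atTop_nat 1).eventually hclose
    obtain ⟨j, hj, hj0, hj1⟩ := (hB.and_eventually (hclose.and hclose1)).exists
    have hs := side 0 j
    have hneg : (v' 0 - v (j + 1)) * (v' 0 - v j) < 0 := by
      by_contra! hcon
      nlinarith
    rw [abs_lt] at hj0 hj1
    rcases lt_or_gt_of_ne (hne' 0) with h | h
    · rw [abs_of_neg h] at hj0 hj1
      nlinarith
    · rw [abs_of_pos h] at hj0 hj1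
      nlinarith
  · rw [not_frequently] at hB
    obtain ⟨J, hJ⟩ := eventually_atTop.1 hB
    have hpos : ∀ k, 0 < (v (J + k) - x) * (v (J + k + 1) - x) := fun k =>
      lt_of_le_of_ne (not_lt.1 (hJ _ (by omega))) (mul_ne_zero (hne _) (hne _)).symm
    have hsame : ∀ k, 0 < (v J - x) * (v (J + k) - x) := fun k => by
      simpa using mul_pos_of_forall_mul_succ_pos (u := fun k => v (J + k) - x) hpos 0 k
    -- Chaining the edges from `v J` onwards shows that no `v' i` lies between `v J` and `x`; yet
    -- `v' i` close to `x` and on that side must.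
    have hout : ∀ i, 0 < (v' i - v J) * (v' i - x) := by
      intro i
      have hlim : Tendsto (fun k => v' i - v (J + k)) atTop (𝓝 (v' i - x)) := by
        have : Tendsto (fun k => v (k + J)) atTop (𝓝 x) := (tendsto_add_atTop_iff_nat J).2 hv
        simp_rw [add_comm J]
        exact this.const_sub _
      refine mul_limit_pos (u := fun k => v' i - v (J + k)) (fun k => ?_) hlim (hne' i) 0
      have h1 := side i (J + k)
      have h2 := hpos k
      have h3 : 0 < (x - v (J + k + 1)) * (x - v (J + k)) := by linarith
      have h4 := pos_of_mul_pos_left h1 h3.le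
      rw [← add_assoc]
      linarith
    have hclose : ∀ᶠ i in atTop, |v' i - x| < |v J - x| := by
      have := (hv'.sub_const x).abs
      rw [sub_self, abs_zero] at this
      exact this.eventually_lt_const (abs_pos.2 (hne J))
    obtain ⟨i, hi, hiJ⟩ := (hclose.and (eventually_ge_atTop J)).exists
    obtain ⟨k, rfl⟩ := Nat.exists_eq_add_of_le hiJ
    have h1 := hsame k
    have h2 := hsgn (J + k)
    have h3 := hout (J + k)
    rcases lt_or_gt_of_ne (hne J) with h | h
    · have h4 : v (J + k) - x < 0 := by by_contra! hcon; nlinarith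
      have h5 : v' (J + k) - x < 0 := by by_contra! hcon; nlinarith
      rw [abs_of_neg h, abs_of_neg h5] at hi
      nlinarith
    · have h4 : 0 < v (J + k) - x := by by_contra! hcon; nlinarith
      have h5 : 0 < v' (J + k) - x := by by_contra! hcon; nlinarith
      rw [abs_of_pos h, abs_of_pos h5] at hi
      nlinarith

/-! ### Eigenvectors -/

/-- The matrix `g` maps the vector `(t, 1)` to `k (x, 1)`. -/
def Carries (g : SL(2, ℝ)) (t x k : ℝ) : Prop :=
  g 0 0 * t + g 0 1 = k * x ∧ g 1 0 * t + g 1 1 = k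

lemma det_eq_one (g : SL(2, ℝ)) : g 0 0 * g 1 1 - g 0 1 * g 1 0 = 1 := by
  rw [← Matrix.det_fin_two, g.det_coe]

lemma mul_apply_two (g g' : SL(2, ℝ)) (i j : Fin 2) :
    (g * g') i j = g i 0 * g' 0 j + g i 1 * g' 1 j := by
  rw [Matrix.SpecialLinearGroup.coe_mul, Matrix.mul_apply, Fin.sum_univ_two]

lemma inv_apply_two (g : SL(2, ℝ)) :
    g⁻¹ 0 0 = g 1 1 ∧ g⁻¹ 0 1 = -g 0 1 ∧ g⁻¹ 1 0 = -g 1 0 ∧ g⁻¹ 1 1 = g 0 0 := by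
  simp [Matrix.SpecialLinearGroup.coe_inv, Matrix.adjugate_fin_two]

lemma Carries.mul {g g' : SL(2, ℝ)} {t x y k k' : ℝ} (hg' : Carries g' x y k')
    (hg : Carries g t x k) : Carries (g' * g) t y (k' * k) := by
  obtain ⟨h1, h2⟩ := hg
  obtain ⟨h3, h4⟩ := hg'
  constructor <;> simp only [mul_apply_two]
  · linear_combination g' 0 0 * h1 + g' 0 1 * h2 + k * h3
  · linear_combination g' 1 0 * h1 + g' 1 1 * h2 + k * h4

lemma Carries.neg {g : SL(2, ℝ)} {t x k : ℝ} (hg : Carries g t x k) : Carries (-g) t x (-k) := by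
  obtain ⟨h1, h2⟩ := hg
  constructor <;> simp only [Matrix.SpecialLinearGroup.coe_neg, Matrix.neg_apply] <;> linarith

lemma Carries.one (x : ℝ) : Carries 1 x x 1 := by simp [Carries]

/-- The row `(1, -x) g` annihilates `(t, 1)`, so it is a multiple of `(1, -t)`; determinant one
makes the factor `1 / k`. -/
lemma Carries.left_mul {g : SL(2, ℝ)} {t x k : ℝ} (hg : Carries g t x k) :
    (g 0 0 - x * g 1 0) * k = 1 := by
  obtain ⟨h1, h2⟩ := hg
  linear_combination det_eq_one g + g 1 0 * h1 - g 0 0 * h2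

lemma Carries.ne_zero {g : SL(2, ℝ)} {t x k : ℝ} (hg : Carries g t x k) : k ≠ 0 :=
  right_ne_zero_of_mul_eq_one hg.left_mul

lemma Carries.inv {g : SL(2, ℝ)} {t x k : ℝ} (hg : Carries g t x k) : Carries g⁻¹ x t k⁻¹ := by
  have hk := hg.ne_zero
  obtain ⟨h1, h2⟩ := hg
  have hd := det_eq_one g
  obtain ⟨e1, e2, e3, e4⟩ := inv_apply_two g
  constructor
  · rw [e1, e2]
    field_simp
    linear_combination t * hd - g 1 1 * h1 + g 0 1 * h2
  · rw [e3, e4]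
    field_simp
    linear_combination hd + g 1 0 * h1 - g 0 0 * h2

lemma Carries.unique {g : SL(2, ℝ)} {t x y k k' : ℝ} (h : Carries g t x k)
    (h' : Carries g t y k') : x = y ∧ k = k' := by
  have hk := h.ne_zero
  have e : k = k' := h.2.symm.trans h'.2
  subst e
  exact ⟨mul_left_cancel₀ hk (h.1.symm.trans h'.1), rfl⟩

lemma Carries.pow {g : SL(2, ℝ)} {x k : ℝ} (hg : Carries g x x k) (n : ℕ) :
    Carries (g ^ n) x x (k ^ n) := by
  induction n with
  | zero => simpa using Carries.one x
  | succ n ih =>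
    rw [pow_succ, pow_succ]
    exact ih.mul hg

lemma Carries.zpow {g : SL(2, ℝ)} {x k : ℝ} (hg : Carries g x x k) (n : ℤ) :
    Carries (g ^ n) x x (k ^ n) := by
  obtain ⟨m, rfl | rfl⟩ := n.eq_nat_or_neg
  · rw [zpow_natCast, zpow_natCast]
    exact hg.pow m
  · rw [zpow_neg, zpow_neg, zpow_natCast, zpow_natCast]
    exact (hg.pow m).inv

lemma Carries.T_zpow (q : ℕ) (k : ℤ) (x : ℝ) : Carries (T q ^ k) x (x + k * lam q) 1 := by
  simp [Carries, T_zpow_eq]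

/-- If `g` has the eigenvectors `(ξ, 1)` and `(η, 1)` with different eigenvalues, then a matrix
commuting with `g` has these eigenvectors as well. -/
lemma Carries.of_commute {g w : SL(2, ℝ)} {ξ η k ω : ℝ} (hξ : Carries g ξ ξ k)
    (hη : Carries g η η k⁻¹) (hk : k ^ 2 ≠ 1) (hw : Carries w ξ ξ ω) (hne : ξ ≠ η)
    (hc : w * g = g * w) : Carries w η η ω⁻¹ := by
  have hk0 := hξ.ne_zero
  have hkk : k * k⁻¹ = 1 := mul_inv_cancel₀ hk0
  have hω := hw.ne_zero
  obtain ⟨a1, a2⟩ := hξ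
  obtain ⟨b1, b2⟩ := hη
  obtain ⟨c1, c2⟩ := hw
  have hcomm : ∀ i j : Fin 2, w i 0 * g 0 j + w i 1 * g 1 j = g i 0 * w 0 j + g i 1 * w 1 j := by
    intro i j
    rw [← mul_apply_two, ← mul_apply_two, hc]
  have h00 := hcomm 0 0
  have h01 := hcomm 0 1
  have h10 := hcomm 1 0
  have h11 := hcomm 1 1
  -- By commutation `w (η, 1)` is again an eigenvector of `g` for `k⁻¹`. Subtracting a multiple of
  -- `(η, 1)` leaves `(δ, 0)`; if `δ ≠ 0`, then `g` is upper triangular and `k = k⁻¹`.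
  set δ := w 0 0 * η + w 0 1 - η * (w 1 0 * η + w 1 1) with hδ
  have e1 : g 0 0 * δ = k⁻¹ * δ := by
    linear_combination (-η) * h00 - h01 + w 0 0 * b1 + w 0 1 * b2 -
      (w 1 0 * η + w 1 1) * b1
  have e2 : g 1 0 * δ = 0 := by
    linear_combination (-η) * h10 - h11 + w 1 0 * b1 + w 1 1 * b2 -
      (w 1 0 * η + w 1 1) * b2
  have hδ0 : δ = 0 := by
    by_contra hne0
    have hc0 : g 1 0 = 0 := (mul_eq_zero.1 e2).resolve_right hne0
    rw [hc0] at a2 b2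
    apply hk
    have : k = k⁻¹ := by linarith
    rw [sq]
    nth_rw 2 [this]
    exact hkk
  have hdet := det_eq_one w
  have hval : ω * (w 1 0 * η + w 1 1) = 1 := by
    have h1 : (ξ - η) * (ω * (w 1 0 * η + w 1 1)) = (ξ - η) * 1 := by
      linear_combination (ξ - η) * hdet - (w 1 0 * η + w 1 1) * c1 + ω * hδ0 +
        (w 0 0 * η + w 0 1) * c2 - ω * hδ
    exact mul_left_cancel₀ (sub_ne_zero.2 hne) h1
  have hval' : w 1 0 * η + w 1 1 = ω⁻¹ := eq_inv_of_mul_eq_one_right hval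
  refine ⟨?_, hval'⟩
  rw [← hval']
  linarith

/-! ### Sequences of group elements converging to a boundary point -/

section Convergence

variable {q : ℕ} {w : ℕ → SL(2, ℝ)} {x : ℝ}

lemma eventually_apply_ne_zero (hq : 3 ≤ q) (hw : ∀ j, w j ∈ group q)
    (hα : Tendsto (fun j => w j 0 0 - x * w j 1 0) atTop (𝓝 0)) :
    ∀ᶠ j in atTop, w j 1 0 ≠ 0 := by
  have h1 : ∀ᶠ j in atTop, |w j 0 0 - x * w j 1 0| < 1 := by
    have := hα.abs
    rw [abs_zero] at this
    exact this.eventually_lt_const one_pos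
  filter_upwards [h1] with j hj hc
  rw [hc, mul_zero, sub_zero] at hj
  have h0 := (entry_eq_zero_or hq (hw j) 0 0).resolve_right (not_le.2 hj)
  have hd := det_eq_one (w j)
  simp [hc, h0] at hd

/-- Nonzero denominators have absolute value at least `1`, so the linear form `a - x c` bounds the
distance of `a / c` from `x`. -/
lemma tendsto_of_tendsto_sub (hq : 3 ≤ q) (hw : ∀ j, w j ∈ group q)
    (hα : Tendsto (fun j => w j 0 0 - x * w j 1 0) atTop (𝓝 0)) :
    Tendsto (fun j => w j 0 0 / w j 1 0) atTop (𝓝 x) := by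
  rw [tendsto_iff_norm_sub_tendsto_zero]
  have h0 : Tendsto (fun j => |w j 0 0 - x * w j 1 0|) atTop (𝓝 0) := by
    simpa using hα.abs
  refine squeeze_zero' (Eventually.of_forall fun j => norm_nonneg _) ?_ h0
  filter_upwards [eventually_apply_ne_zero hq hw hα] with j hj
  have h1 := (entry_eq_zero_or hq (hw j) 1 0).resolve_left hj
  have e : w j 0 0 / w j 1 0 - x = (w j 0 0 - x * w j 1 0) / w j 1 0 := by
    field_simp
  rw [e, Real.norm_eq_abs, abs_div]
  exact div_le_self (abs_nonneg _) h1

/-- A path of edges of the tessellation that ends in `x` and its image under an element of the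
Hecke group fixing `x` have a common vertex. -/
lemma exists_common_vertex (hq : 3 ≤ q) (hw : ∀ j, w j ∈ group q)
    (hstep : ∀ j k, w (j + 1) k 0 = w j k 1)
    (hα : Tendsto (fun j => w j 0 0 - x * w j 1 0) atTop (𝓝 0))
    (hα0 : ∀ j, w j 0 0 - x * w j 1 0 ≠ 0) {g : SL(2, ℝ)} (hg : g ∈ group q) {κ : ℝ}
    (hgx : Carries g x x κ) : ∃ i j, ((w j)⁻¹ * (g * w i)) 1 0 = 0 := by
  have hκ := hgx.ne_zero
  have hgw : ∀ j, g * w j ∈ group q := fun j => mul_mem hg (hw j)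
  have hrel : ∀ j, (g * w j) 0 0 - x * (g * w j) 1 0 = κ⁻¹ * (w j 0 0 - x * w j 1 0) := by
    intro j
    have h1 : g 0 0 - x * g 1 0 = κ⁻¹ := eq_inv_of_mul_eq_one_left hgx.left_mul
    rw [← h1, mul_apply_two, mul_apply_two]
    linear_combination w j 1 0 * hgx.1 - x * w j 1 0 * hgx.2
  have hα' : Tendsto (fun j => (g * w j) 0 0 - x * (g * w j) 1 0) atTop (𝓝 0) := by
    simp_rw [hrel]
    simpa using hα.const_mul κ⁻¹
  have hv := tendsto_of_tendsto_sub hq hw hα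
  have hv' := tendsto_of_tendsto_sub hq hgw hα'
  -- The limit is `κ² > 0`: near its fixed point `x`, `g` preserves the two sides of `x`.
  have hpos : ∀ᶠ j in atTop, 0 < κ * (g 1 0 * (w j 0 0 / w j 1 0) + g 1 1) := by
    have h1 : Tendsto (fun j => κ * (g 1 0 * (w j 0 0 / w j 1 0) + g 1 1)) atTop
        (𝓝 (κ * (g 1 0 * x + g 1 1))) := ((hv.const_mul _).add_const _).const_mul _
    refine h1.eventually_const_lt ?_
    rw [hgx.2]
    exact mul_self_pos.2 hκ
  obtain ⟨J, hJ⟩ := eventually_atTop.1 ((eventually_apply_ne_zero hq hw hα).and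
    ((eventually_apply_ne_zero hq hgw hα').and hpos))
  have hsgn : ∀ i, 0 < ((g * w (i + J)) 0 0 / (g * w (i + J)) 1 0 - x) *
      (w (i + J) 0 0 / w (i + J) 1 0 - x) := by
    intro i
    obtain ⟨h1, h2, h3⟩ := hJ (i + J) (by omega)
    have h4 := hrel (i + J)
    have h5 := hα0 (i + J)
    have e : (g * w (i + J)) 1 0 =
        w (i + J) 1 0 * (g 1 0 * (w (i + J) 0 0 / w (i + J) 1 0) + g 1 1) := by
      rw [mul_apply_two]
      field_simp
    set y := g 1 0 * (w (i + J) 0 0 / w (i + J) 1 0) + g 1 1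
    have hy : y ≠ 0 := right_ne_zero_of_mul h3.ne'
    have e1 : (g * w (i + J)) 0 0 / (g * w (i + J)) 1 0 - x =
        ((g * w (i + J)) 0 0 - x * (g * w (i + J)) 1 0) / (g * w (i + J)) 1 0 := by
      field_simp
    have e2 : w (i + J) 0 0 / w (i + J) 1 0 - x =
        (w (i + J) 0 0 - x * w (i + J) 1 0) / w (i + J) 1 0 := by
      field_simp
    rw [e1, e2, h4, e]
    have e3 : κ⁻¹ * (w (i + J) 0 0 - x * w (i + J) 1 0) / (w (i + J) 1 0 * y) *
        ((w (i + J) 0 0 - x * w (i + J) 1 0) / w (i + J) 1 0) =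
        (w (i + J) 0 0 - x * w (i + J) 1 0) ^ 2 / (w (i + J) 1 0 ^ 2 * (κ * y)) := by
      field_simp
    rw [e3]
    positivity
  -- Non-crossing of the edges of `w j` and `g * w i` is `prod_entries_nonneg` for `(w j)⁻¹ * (g * w
  -- i)`, rewritten after division by a square.
  have hnc : ∀ i j, 0 ≤
      ((g * w (i + J)) 0 0 / (g * w (i + J)) 1 0 - w (j + 1 + J) 0 0 / w (j + 1 + J) 1 0) *
      ((g * w (i + 1 + J)) 0 0 / (g * w (i + 1 + J)) 1 0 -
        w (j + 1 + J) 0 0 / w (j + 1 + J) 1 0) *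
      ((w (j + J) 0 0 / w (j + J) 1 0 - (g * w (i + J)) 0 0 / (g * w (i + J)) 1 0) *
      (w (j + J) 0 0 / w (j + J) 1 0 - (g * w (i + 1 + J)) 0 0 / (g * w (i + 1 + J)) 1 0)) := by
    intro i j
    have h1 := (hJ (i + J) (by omega)).2.1
    have h2 := (hJ (i + 1 + J) (by omega)).2.1
    have h3 := (hJ (j + J) (by omega)).1
    have h4 := (hJ (j + 1 + J) (by omega)).1
    have hmem : (w (j + J))⁻¹ * (g * w (i + J)) ∈ group q := mul_mem (inv_mem (hw _)) (hgw _)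
    have hnn := prod_entries_nonneg hq hmem
    have s1 : ∀ k, w (j + 1 + J) k 0 = w (j + J) k 1 := fun k => by
      rw [show j + 1 + J = j + J + 1 by omega, hstep]
    have s2 : ∀ k, (g * w (i + 1 + J)) k 0 = (g * w (i + J)) k 1 := fun k => by
      rw [show i + 1 + J = i + J + 1 by omega, mul_apply_two, mul_apply_two, hstep, hstep]
    simp only [mul_apply_two (w (j + J))⁻¹, inv_apply_two, ← s1, ← s2] at hnn
    generalize (g * w (i + J)) 0 0 = a at *
    generalize (g * w (i + J)) 1 0 = c at *
    generalize (g * w (i + 1 + J)) 0 0 = b at *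
    generalize (g * w (i + 1 + J)) 1 0 = d at *
    generalize w (j + J) 0 0 = a' at *
    generalize w (j + J) 1 0 = c' at *
    generalize w (j + 1 + J) 0 0 = b' at *
    generalize w (j + 1 + J) 1 0 = d' at *
    have e : (a / c - b' / d') * (b / d - b' / d') * ((a' / c' - a / c) * (a' / c' - b / d)) =
        ((d' * a + -b' * c) * (-c' * a + a' * c) * ((d' * b + -b' * d) * (-c' * b + a' * d))) /
          (c * d * c' * d') ^ 2 := by
      field_simp
      ring
    rw [e]
    positivity
  obtain ⟨i, j, hij⟩ := exists_eq_of_noncrossing (x := x)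
    (v := fun k => w (k + J) 0 0 / w (k + J) 1 0)
    (v' := fun k => (g * w (k + J)) 0 0 / (g * w (k + J)) 1 0)
    ((tendsto_add_atTop_iff_nat (f := fun k => w k 0 0 / w k 1 0) J).2 hv)
    ((tendsto_add_atTop_iff_nat (f := fun k => (g * w k) 0 0 / (g * w k) 1 0) J).2 hv')
    hsgn hnc
  refine ⟨i + J, j + J, ?_⟩
  have h1 := (hJ (j + J) (by omega)).1
  have h2 := (hJ (i + J) (by omega)).2.1
  rw [div_eq_div_iff h1 h2] at hij
  rw [mul_apply_two, (inv_apply_two _).2.2.1, (inv_apply_two _).2.2.2]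
  linarith

end Convergence

/-! ### Regular expansions -/

lemma symFloor_le (y : ℝ) : (symFloor y : ℝ) ≤ y ∧ y ≤ symFloor y + 1 := by
  unfold symFloor
  split_ifs with h
  · push_cast
    constructor
    · linarith [Int.ceil_lt_add_one y]
    · linarith [Int.le_ceil y]
  · exact ⟨Int.floor_le y, (Int.lt_floor_add_one y).le⟩

lemma abs_sub_nearest_le {q : ℕ} (hq : 3 ≤ q) (z : ℝ) :
    |z - nearest q z * lam q| ≤ lam q / 2 := by
  have hl := lam_pos hq
  obtain ⟨h1, h2⟩ := symFloor_le (z / lam q + 1 / 2)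
  have e : z = z / lam q * lam q := by field_simp
  rw [abs_le]
  unfold nearest
  constructor <;> nlinarith

/-- `t 0, t 1, …` are the successive remainders of an infinite expansion with digits `a`. -/
structure IsExpansion (q : ℕ) (t : ℕ → ℝ) (a : ℕ → ℤ) : Prop where
  ne_zero : ∀ j, t j ≠ 0
  abs_le : ∀ j, |t j| ≤ lam q / 2
  succ : ∀ j, t (j + 1) = -1 / t j - a j * lam q

lemma HasInfiniteCode.isExpansion {q : ℕ} (hq : 3 ≤ q) {x : ℝ} {a : ℕ → ℤ}
    (hc : HasInfiniteCode q x 0 a) : IsExpansion q (fun j => (F q)^[j] x) a := by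
  obtain ⟨h0, h1⟩ := hc
  have ht : ∀ j, tail q x j = (F q)^[j] x := fun j => by simp [tail, h0]
  simp_rw [ht] at h1
  refine ⟨fun j => (h1 j).1, fun j => ?_, fun j => ?_⟩
  · cases j with
    | zero => simpa [h0] using abs_sub_nearest_le hq x
    | succ j =>
      rw [Function.iterate_succ_apply', F, if_neg (h1 j).1]
      exact abs_sub_nearest_le hq _
  · rw [Function.iterate_succ_apply', F, if_neg (h1 j).1, (h1 j).2]

lemma word_initial_succ (q : ℕ) (a : ℕ → ℤ) (j : ℕ) :
    word q (initial a (j + 1)) = word q (initial a j) * (S * T q ^ a j) := by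
  simp [word, initial, List.range_succ]

lemma word_mem (q : ℕ) (l : List ℤ) : word q l ∈ group q := by
  refine Subgroup.list_prod_mem _ fun g hg => ?_
  obtain ⟨c, -, rfl⟩ := List.mem_map.1 hg
  exact mul_mem (S_mem q) (zpow_mem (T_mem q) c)

lemma word_initial_succ_apply (q : ℕ) (a : ℕ → ℤ) (j : ℕ) (k : Fin 2) :
    word q (initial a (j + 1)) k 0 = word q (initial a j) k 1 := by
  rw [word_initial_succ, mul_apply_two, mul_apply_two, mul_apply_two, coe_S, T_zpow_eq]
  simp

lemma word_initial_add (q : ℕ) {a : ℕ → ℤ} {n : ℕ} (ha : Function.Periodic a n) (k j : ℕ) :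
    word q (initial a (n * k + j)) = word q (initial a n) ^ k * word q (initial a j) := by
  have h1 : ∀ j, word q (initial a (n + j)) = word q (initial a n) * word q (initial a j) := by
    intro j
    induction j with
    | zero => simp [word, initial]
    | succ j ih =>
      rw [← add_assoc, word_initial_succ, ih, word_initial_succ, mul_assoc, add_comm n j, ha j]
  induction k with
  | zero => simp
  | succ k ih =>
    rw [pow_succ', mul_assoc, ← ih, ← h1]
    congr 2
    ring

namespace IsExpansion

variable {q : ℕ} {t : ℕ → ℝ} {a : ℕ → ℤ}

lemma shift (ht : IsExpansion q t a) (m : ℕ) :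
    IsExpansion q (fun j => t (j + m)) (fun j => a (j + m)) where
  ne_zero j := ht.ne_zero _
  abs_le j := ht.abs_le _
  succ j := by
    rw [add_right_comm]
    exact ht.succ _

lemma carries (ht : IsExpansion q t a) (j : ℕ) :
    Carries (word q (initial a j)) (t j) (t 0) (∏ i ∈ Finset.range j, (-1 / t i)) := by
  induction j with
  | zero => simpa [word, initial] using Carries.one (t 0)
  | succ j ih =>
    rw [word_initial_succ, Finset.prod_range_succ]
    refine ih.mul ?_
    have h0 := ht.ne_zero j
    have hs := ht.succ j
    constructor <;> simp only [mul_apply_two, coe_S, T_zpow_eq] <;> simp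
    · field_simp
    · rw [hs]
      ring

lemma sub_eq (ht : IsExpansion q t a) (j : ℕ) :
    word q (initial a j) 0 0 - t 0 * word q (initial a j) 1 0 =
      ∏ i ∈ Finset.range j, (-t i) := by
  have h1 := (ht.carries j).left_mul
  rw [eq_inv_of_mul_eq_one_left h1, ← Finset.prod_inv_distrib]
  exact Finset.prod_congr rfl fun i _ => by rw [inv_div, div_neg, div_one]

lemma tendsto_sub (hq : 3 ≤ q) (ht : IsExpansion q t a) :
    Tendsto (fun j => word q (initial a j) 0 0 - t 0 * word q (initial a j) 1 0) atTop (𝓝 0) := by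
  have hl := lam_bounds hq
  refine squeeze_zero_norm (a := fun j => (lam q / 2) ^ j) (fun j => ?_)
    (tendsto_pow_atTop_nhds_zero_of_lt_one (by linarith) (by linarith))
  rw [ht.sub_eq, Real.norm_eq_abs, Finset.abs_prod]
  calc ∏ i ∈ Finset.range j, |(-t i)| ≤ ∏ _i ∈ Finset.range j, lam q / 2 :=
        Finset.prod_le_prod (fun _ _ => abs_nonneg _) fun i _ => by
          rw [abs_neg]
          exact ht.abs_le i
    _ = (lam q / 2) ^ j := by rw [Finset.prod_const, Finset.card_range]

lemma sub_ne_zero (ht : IsExpansion q t a) (j : ℕ) :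
    word q (initial a j) 0 0 - t 0 * word q (initial a j) 1 0 ≠ 0 := by
  rw [ht.sub_eq]
  exact Finset.prod_ne_zero_iff.2 fun i _ => neg_ne_zero.2 (ht.ne_zero i)

lemma convergesTo (hq : 3 ≤ q) (ht : IsExpansion q t a) : ConvergesTo q a (t 0) := by
  have hmem := fun j => word_mem q (initial a j)
  have h1 := (tendsto_add_atTop_iff_nat 1).2
    (tendsto_of_tendsto_sub hq hmem (ht.tendsto_sub hq))
  have h2 := (tendsto_add_atTop_nat 1).eventually
    (eventually_apply_ne_zero hq hmem (ht.tendsto_sub hq))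
  refine ((OnePoint.continuous_coe.tendsto (t 0)).comp h1).congr' ?_
  filter_upwards [h2] with j hj
  rw [word_initial_succ_apply] at hj
  simp only [Function.comp_apply, word_initial_succ_apply, finitePoint, bdAct]
  rw [OnePoint.smul_some_eq_ite]
  simp [hj]

/-- With equal digits, `t' - t = t' t (t'₊ - t₊)`, where `₊` marks the next remainder. Iterating the
factor `(λ/2)² < 1` forces equality. -/
lemma eq_of_periodic (hq : 3 ≤ q) (ht : IsExpansion q t a) {n : ℕ}
    (ha : Function.Periodic a n) (j : ℕ) : t (j + n) = t j := by
  have hl := lam_bounds hq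
  set c := lam q / 2 with hc
  have hc1 : c < 1 := by linarith
  have hc0 : 0 < c := by linarith
  have hstep : ∀ j, |t (j + n) - t j| ≤ c ^ 2 * |t (j + 1 + n) - t (j + 1)| := by
    intro j
    have h1 := ht.ne_zero j
    have h2 := ht.ne_zero (j + n)
    have h3 : t (j + n) - t j = t (j + n) * t j * (t (j + 1 + n) - t (j + 1)) := by
      rw [add_right_comm, ht.succ, ht.succ, ha j]
      field_simp
      ring
    rw [h3, abs_mul, abs_mul, sq]
    have h4 := ht.abs_le j
    have h5 := ht.abs_le (j + n)
    gcongr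
  have hpow : ∀ k j, |t (j + n) - t j| ≤ (c ^ 2) ^ k * (2 * c) := by
    intro k
    induction k with
    | zero =>
      intro j
      have h4 := _root_.abs_le.1 (ht.abs_le j)
      have h5 := _root_.abs_le.1 (ht.abs_le (j + n))
      rw [pow_zero, one_mul, _root_.abs_le]
      constructor <;> linarith
    | succ k ih =>
      intro j
      calc _ ≤ c ^ 2 * |t (j + 1 + n) - t (j + 1)| := hstep j
        _ ≤ c ^ 2 * ((c ^ 2) ^ k * (2 * c)) := by gcongr; exact ih _
        _ = _ := by ring
  have hlim : Tendsto (fun k : ℕ => (c ^ 2) ^ k * (2 * c)) atTop (𝓝 0) := by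
    have := tendsto_pow_atTop_nhds_zero_of_lt_one (r := c ^ 2) (by positivity) (by nlinarith)
    simpa using this.mul_const (2 * c)
  have h0 : |t (j + n) - t j| ≤ 0 := ge_of_tendsto' hlim fun k => hpow k j
  exact _root_.sub_eq_zero.1 (abs_eq_zero.1 (le_antisymm h0 (abs_nonneg _)))

end IsExpansion

/-! ### The stabilizer of a point with a periodic expansion -/

/-- Otherwise `x` would be the image of a cusp; `-λ/2` reduces to `λ/2` by `T⁻¹`. -/
lemma abs_ne_half_lam {q : ℕ} (hq : 3 ≤ q) {x : ℝ} (hx : x ∈ irrationalPoints q) {g : SL(2, ℝ)}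
    (hg : g ∈ group q) {t k : ℝ} (hgt : Carries g t x k) : |t| ≠ lam q / 2 := by
  have hl := lam_pos hq
  have main : ∀ g ∈ group q, ∀ k, ¬ Carries g (lam q / 2) x k := by
    intro g hg k hgt
    obtain ⟨p, hp, hp1, hp0⟩ := half_lam_cusp hq
    have hk := hgt.ne_zero
    have e1 : (g * p) 1 0 = p 1 0 * k := by
      rw [mul_apply_two, hp0, ← hgt.2]
      ring
    have e0 : (g * p) 0 0 = p 1 0 * (k * x) := by
      rw [mul_apply_two, hp0, ← hgt.1]
      ring
    refine hx (g * p) (mul_mem hg hp) ?_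
    rw [bdAct, OnePoint.smul_infty_eq_ite]
    have h1 : (g * p) 1 0 ≠ 0 := by
      rw [e1]
      exact mul_ne_zero hp1 hk
    have h2 : (g * p) 0 0 / (g * p) 1 0 = x := by
      rw [e0, e1]
      field_simp
    refine (if_neg h1).trans ?_
    exact congrArg _ h2
  intro habs
  rcases (abs_eq (by linarith)).1 habs with h | h
  · exact main g hg k (h ▸ hgt)
  · refine main (g * T q ^ (-1 : ℤ)) (mul_mem hg (zpow_mem (T_mem q) _)) (k * 1) (hgt.mul ?_)
    have := Carries.T_zpow q (-1) (lam q / 2)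
    rw [h]
    convert this using 1
    push_cast
    ring

/-- The stabilizer of a point with a periodic expansion is generated, up to sign, by the word of
one minimal period. -/
lemma eq_zpow_word {q : ℕ} (hq : 3 ≤ q) {x : ℝ} (hx : x ∈ irrationalPoints q) {a : ℕ → ℤ}
    (hcode : HasInfiniteCode q x 0 a) {n : ℕ}
    (hn : IsLeast {m : ℕ | 0 < m ∧ Function.Periodic a m} n) {g : SL(2, ℝ)} (hg : g ∈ group q)
    {κ : ℝ} (hgx : Carries g x x κ) :
    ∃ k : ℤ, g = word q (initial a n) ^ k ∨ g = -word q (initial a n) ^ k := by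
  obtain ⟨⟨hn0, hper⟩, hmin⟩ := hn
  have ht := hcode.isExpansion hq
  have hl := lam_bounds hq
  have hmem := fun j => word_mem q (initial a j)
  obtain ⟨i, j, hij⟩ := exists_common_vertex hq hmem (word_initial_succ_apply q a)
    (ht.tendsto_sub hq) ht.sub_ne_zero hg hgx
  have hfix := ht.eq_of_periodic hq hper
  have hc := (ht.carries j).inv.mul (hgx.mul (ht.carries i))
  obtain ⟨k, hk⟩ := eq_T_zpow_of_apply_eq_zero hq
    (mul_mem (inv_mem (hmem j)) (mul_mem hg (hmem i))) hij
  have hT := Carries.T_zpow q k ((F q)^[i] x)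
  have hshift : (F q)^[j] x = (F q)^[i] x + k * lam q := by
    rcases hk with hk | hk <;> rw [hk] at hc
    · exact (hc.unique hT).1
    · exact (hc.unique hT.neg).1
  have hi := lt_of_le_of_ne (ht.abs_le i) (abs_ne_half_lam hq hx (hmem i) (ht.carries i))
  have hj := lt_of_le_of_ne (ht.abs_le j) (abs_ne_half_lam hq hx (hmem j) (ht.carries j))
  have hk0 : k = 0 := by
    rw [abs_lt] at hi hj
    have h1 : (k : ℝ) < 1 := by
      by_contra! h
      nlinarith
    have h2 : (-1 : ℝ) < k := by
      by_contra! h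
      nlinarith
    have h1' : k < 1 := by exact_mod_cast h1
    have h2' : -1 < k := by exact_mod_cast h2
    omega
  rw [hk0] at hk hshift
  rw [Int.cast_zero, zero_mul, add_zero] at hshift
  have hper_x : Function.IsPeriodicPt (F q) n x := by
    have := hfix 0
    rwa [Nat.zero_add] at this
  -- Digits and remainders determine each other, so the minimal period of the code equals that of
  -- `x` under `F q`.
  have hdvd : ∀ m, Function.IsPeriodicPt (F q) m x → n ∣ m := by
    intro m hm
    have hp : 0 < Function.minimalPeriod (F q) x := hper_x.minimalPeriod_pos hn0
    have hpa : Function.Periodic a (Function.minimalPeriod (F q) x) := by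
      intro l
      have h1 : (F q)^[l + Function.minimalPeriod (F q) x] x = (F q)^[l] x := by
        rw [Function.iterate_add_apply, Function.iterate_minimalPeriod]
      have ht0 : ∀ j, tail q x j = (F q)^[j] x := fun j => by simp [tail, hcode.1]
      rw [← (hcode.2 l).2, ← (hcode.2 _).2, ht0, ht0, h1]
    have h1 : n ≤ Function.minimalPeriod (F q) x := hmin ⟨hp, hpa⟩
    have h2 : Function.minimalPeriod (F q) x ≤ n := hper_x.minimalPeriod_le hn0
    rw [le_antisymm h1 h2]
    exact hm.minimalPeriod_dvd
  -- Applying `F q` until a multiple of `n` steps is completed carries the coincidence at index `i`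
  -- back to `x`.
  have hmod : ∀ i m, (F q)^[i + m] x = (F q)^[i] x → n ∣ m := by
    intro i m him
    refine hdvd m ?_
    have h1 : (F q)^[n * i] x = x := (hper_x.mul_const i)
    have h2 : (F q)^[n * i - i] ((F q)^[i + m] x) = (F q)^[n * i - i] ((F q)^[i] x) := by rw [him]
    have h3 : i ≤ n * i := Nat.le_mul_of_pos_left i hn0
    rw [← Function.iterate_add_apply, ← Function.iterate_add_apply,
      show n * i - i + (i + m) = m + n * i by omega, show n * i - i + i = n * i by omega,
      Function.iterate_add_apply, h1] at h2
    exact h2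
  have hword : ∃ k : ℤ, word q (initial a j) = word q (initial a n) ^ k * word q (initial a i) := by
    rcases le_total i j with h | h
    · obtain ⟨m, rfl⟩ := Nat.exists_eq_add_of_le h
      obtain ⟨k, rfl⟩ := hmod i m hshift
      exact ⟨k, by rw [add_comm, word_initial_add q hper, zpow_natCast]⟩
    · obtain ⟨m, rfl⟩ := Nat.exists_eq_add_of_le h
      obtain ⟨k, rfl⟩ := hmod j m hshift.symm
      refine ⟨-k, ?_⟩
      rw [add_comm, word_initial_add q hper, zpow_neg, zpow_natCast, inv_mul_cancel_left]
  obtain ⟨k, hw⟩ := hword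
  refine ⟨k, ?_⟩
  rw [zpow_zero] at hk
  rcases hk with hk | hk
  · left
    have := inv_mul_eq_one.1 hk
    exact (mul_right_cancel (hw.symm.trans this)).symm
  · right
    have := inv_mul_eq_iff_eq_mul.1 hk
    rw [mul_neg_one, hw, ← neg_mul] at this
    exact mul_right_cancel this

/-! ### Translations along a geodesic -/

section Geodesic

variable {ξ η : ℝ} (hne : ξ ≠ η)

lemma geodesic_re (s : ℝ) : (geodesic ξ η hne s).re =
    (η + ξ * Real.exp s ^ 2) / (1 + Real.exp s ^ 2) := by
  have hX := Real.exp_pos s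
  change (ξ + η) / 2 + (ξ - η) / 2 * Real.tanh s = _
  rw [Real.tanh_eq_sinh_div_cosh, Real.sinh_eq, Real.cosh_eq, Real.exp_neg]
  field_simp
  ring

lemma geodesic_im (s : ℝ) : (geodesic ξ η hne s).im =
    |ξ - η| * Real.exp s / (1 + Real.exp s ^ 2) := by
  have hX := Real.exp_pos s
  change |ξ - η| / 2 / Real.cosh s = _
  rw [Real.cosh_eq, Real.exp_neg]
  field_simp
  ring

lemma smul_eq_iff (g : SL(2, ℝ)) (z z' : ℍ) : g • z = z' ↔
    g 0 0 * z.re + g 0 1 = z'.re * (g 1 0 * z.re + g 1 1) - z'.im * (g 1 0 * z.im) ∧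
      g 0 0 * z.im = z'.re * (g 1 0 * z.im) + z'.im * (g 1 0 * z.re + g 1 1) := by
  have hden : ((g 1 0 : ℝ) : ℂ) * z + ((g 1 1 : ℝ) : ℂ) ≠ 0 := by
    intro h
    have him := congrArg Complex.im h
    have hre := congrArg Complex.re h
    simp at him hre
    have h10 : g 1 0 = 0 := him.resolve_right z.im_pos.ne'
    rw [h10] at hre
    have hd := det_eq_one g
    simp only [h10] at hd
    have : g 1 1 = 0 := by linarith
    rw [this] at hd
    simp at hd
  rw [UpperHalfPlane.ext_iff, UpperHalfPlane.coe_specialLinearGroup_apply]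
  simp only [Algebra.algebraMap_self, RingHom.id_apply]
  rw [div_eq_iff hden, Complex.ext_iff]
  simp

/-- A matrix moves the geodesic from `η` to `ξ` along itself by `t` if and only if `(ξ, 1)` and
`(η, 1)` are eigenvectors with eigenvalues `k` and `1 / k` such that `k ^ 2 = exp t`. -/
lemma smul_geodesic_iff (g : SL(2, ℝ)) (t : ℝ) :
    (∀ s, g • geodesic ξ η hne s = geodesic ξ η hne (s + t)) ↔
      ∃ k, Carries g ξ ξ k ∧ Carries g η η k⁻¹ ∧ k ^ 2 = Real.exp t := by
  have hτ := Real.exp_pos t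
  have hδ : 0 < |ξ - η| := abs_pos.2 (sub_ne_zero.2 hne)
  have hδ2 : |ξ - η| ^ 2 = (ξ - η) ^ 2 := sq_abs _
  simp only [smul_eq_iff, geodesic_re, geodesic_im, Real.exp_add]
  generalize Real.exp t = τ at *
  generalize |ξ - η| = δ at *
  have hiff : ∀ X : ℝ, 0 < X →
      ((g 0 0 * ((η + ξ * X ^ 2) / (1 + X ^ 2)) + g 0 1 =
        (η + ξ * (X * τ) ^ 2) / (1 + (X * τ) ^ 2) *
          (g 1 0 * ((η + ξ * X ^ 2) / (1 + X ^ 2)) + g 1 1) -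
        δ * (X * τ) / (1 + (X * τ) ^ 2) * (g 1 0 * (δ * X / (1 + X ^ 2))) ∧
      g 0 0 * (δ * X / (1 + X ^ 2)) =
        (η + ξ * (X * τ) ^ 2) / (1 + (X * τ) ^ 2) * (g 1 0 * (δ * X / (1 + X ^ 2))) +
        δ * (X * τ) / (1 + (X * τ) ^ 2) * (g 1 0 * ((η + ξ * X ^ 2) / (1 + X ^ 2)) + g 1 1)) ↔
      ((g 0 0 * (η + ξ * X ^ 2) + g 0 1 * (1 + X ^ 2)) * (1 + (X * τ) ^ 2) =
        (η + ξ * (X * τ) ^ 2) * (g 1 0 * (η + ξ * X ^ 2) + g 1 1 * (1 + X ^ 2)) -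
          (ξ - η) ^ 2 * X ^ 2 * τ * g 1 0 ∧
      g 0 0 * (1 + (X * τ) ^ 2) = (η + ξ * (X * τ) ^ 2) * g 1 0 +
        τ * (g 1 0 * (η + ξ * X ^ 2) + g 1 1 * (1 + X ^ 2)))) := by
    intro X hX
    have h1 : 1 + X ^ 2 ≠ 0 := by positivity
    have h2 : 1 + (X * τ) ^ 2 ≠ 0 := by positivity
    have h3 : δ * X / ((1 + X ^ 2) * (1 + (X * τ) ^ 2)) ≠ 0 := by positivity
    have h4 : 1 / ((1 + X ^ 2) * (1 + (X * τ) ^ 2)) ≠ 0 := by positivity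
    rw [← hδ2]
    refine and_congr (Iff.trans ?_ (mul_right_inj' h4)) (Iff.trans ?_ (mul_right_inj' h3))
    all_goals
      constructor
      all_goals
        intro h
        convert h using 1 <;> field_simp
  constructor
  · intro h
    have hX : ∀ X : ℝ, 0 < X → _ := fun X hX => by
      have := h (Real.log X)
      rw [Real.exp_log hX] at this
      exact (hiff X hX).1 this
    -- The real equation is quadratic in `X²` and the imaginary one linear, so three and two values
    -- of `X` determine their coefficients.
    obtain ⟨r1, i1⟩ := hX 1 one_pos
    obtain ⟨r2, i2⟩ := hX 2 two_pos
    obtain ⟨r3, -⟩ := hX 3 three_pos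
    have hi0 : g 0 0 - η * g 1 0 = τ * (g 1 0 * η + g 1 1) := by linarith
    have hr0 : g 0 0 * η + g 0 1 = η * (g 1 0 * η + g 1 1) := by linarith
    have hr4 : τ ^ 2 * (g 0 0 * ξ + g 0 1) = τ ^ 2 * (ξ * (g 1 0 * ξ + g 1 1)) := by linarith
    have hξ := mul_left_cancel₀ (by positivity) hr4
    have hd := det_eq_one g
    have hsub := sub_ne_zero.2 hne
    have hprod : (g 1 0 * ξ + g 1 1) * (g 1 0 * η + g 1 1) = 1 := by
      refine mul_left_cancel₀ hsub ?_
      linear_combination (ξ - η) * hd - (g 1 0 * η + g 1 1) * hξ + (g 1 0 * ξ + g 1 1) * hr0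
    have hC : g 1 0 * ξ + g 1 1 = τ * (g 1 0 * η + g 1 1) := by
      refine mul_left_cancel₀ hsub ?_
      linear_combination (ξ - η) * hi0 - hξ + hr0
    refine ⟨g 1 0 * ξ + g 1 1, ⟨by linarith, rfl⟩, ⟨?_, ?_⟩, ?_⟩
    · rw [← eq_inv_of_mul_eq_one_right hprod, hr0, mul_comm]
    · exact eq_inv_of_mul_eq_one_right hprod
    · rw [sq]
      nth_rw 2 [hC]
      linear_combination τ * hprod
  · rintro ⟨k, hξ, hη, hk⟩ s
    rw [hiff _ (Real.exp_pos s)]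
    have hk0 := hξ.ne_zero
    obtain ⟨a1, a2⟩ := hξ
    obtain ⟨b1, b2⟩ := hη
    have hkk : k * k⁻¹ = 1 := mul_inv_cancel₀ hk0
    generalize k⁻¹ = m at *
    generalize Real.exp s = X
    subst hk
    have hsub := sub_ne_zero.2 hne
    have ha : (ξ - η) * g 0 0 = k * ξ - m * η := by linarith
    have hc : (ξ - η) * g 1 0 = k - m := by linarith
    have hkm : k ^ 2 * m = k := by linear_combination k * hkk
    constructor
    · have e1 : g 0 0 * (η + ξ * X ^ 2) + g 0 1 * (1 + X ^ 2) = m * η + k * ξ * X ^ 2 := by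
        linear_combination b1 + X ^ 2 * a1
      have e2 : g 1 0 * (η + ξ * X ^ 2) + g 1 1 * (1 + X ^ 2) = m + k * X ^ 2 := by
        linear_combination b2 + X ^ 2 * a2
      rw [e1, e2]
      linear_combination (ξ - η) * X ^ 2 * k ^ 2 * hc + X ^ 2 * (1 + k ^ 2) * (η - ξ) * hkm
    · have e2 : g 1 0 * (η + ξ * X ^ 2) + g 1 1 * (1 + X ^ 2) = m + k * X ^ 2 := by
        linear_combination b2 + X ^ 2 * a2
      rw [e2]
      refine mul_left_cancel₀ hsub ?_
      linear_combination (1 + (X * k ^ 2) ^ 2) * ha - (η + ξ * (X * k ^ 2) ^ 2) * hc +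
        (ξ - η) * (X ^ 2 * k ^ 2 - 1) * hkm

end Geodesic

/-- The length formula: the least period of a closed geodesic whose end point has the periodic
code `a`. -/
lemma isLength_of_code {q : ℕ} (hq : 3 ≤ q) {ξ η : ℝ} (hne : ξ ≠ η)
    (hirr : -1 / ξ ∈ irrationalPoints q) (hclosed : IsClosedGeodesic q ξ η hne)
    {n : ℕ} {a : ℕ → ℤ} (hcode : HasInfiniteCode q (-1 / ξ) 0 a)
    (hn : IsLeast {m : ℕ | 0 < m ∧ Function.Periodic a m} n) :
    IsLength q ξ η hne (2 * ∑ j ∈ Finset.Icc 1 n, Real.log |xi q ξ j|) := by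
  have ht := hcode.isExpansion hq
  have hl := lam_bounds hq
  have hξ0 : ξ ≠ 0 := by
    rintro rfl
    exact ht.ne_zero 0 (by simp)
  have hfix := ht.eq_of_periodic hq hn.1.2 0
  simp only [zero_add, Function.iterate_zero, id_eq] at hfix
  set ω := ∏ i ∈ Finset.range n, (-1 / (F q)^[i] (-1 / ξ)) with hω
  set ℓ := 2 * ∑ j ∈ Finset.Icc 1 n, Real.log |xi q ξ j| with hℓ
  have hW : Carries (word q (initial a n)) (-1 / ξ) (-1 / ξ) ω := by
    have := ht.carries n
    simp only [hfix, Function.iterate_zero, id_eq] at this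
    exact this
  -- The formula runs over `1, …, n`, the eigenvalue over `0, …, n - 1`; the two agree since `ξ_n =
  -- ξ_0`.
  have hsum : ∑ j ∈ Finset.Icc 1 n, Real.log |xi q ξ j| =
      ∑ j ∈ Finset.range n, Real.log |xi q ξ j| := by
    have h1 : ∀ (u : ℕ → ℝ) (n : ℕ), ∑ j ∈ Finset.Icc 1 n, u j + u 0 =
        ∑ j ∈ Finset.range n, u j + u n := by
      intro u n
      induction n with
      | zero => simp
      | succ n ih =>
        rw [Finset.sum_Icc_succ_top (by omega), Finset.sum_range_succ]
        linarith
    have h2 : xi q ξ n = xi q ξ 0 := by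
      rw [xi, xi, hfix, Function.iterate_zero, id_eq]
    have h3 := h1 (fun j => Real.log |xi q ξ j|) n
    simp only [h2] at h3
    linarith
  have hxi0 : ∀ j, 1 < |xi q ξ j| := by
    intro j
    rw [xi, abs_div, abs_neg, abs_one, one_lt_div (abs_pos.2 (ht.ne_zero j))]
    linarith [ht.abs_le j]
  have hexp : Real.exp ℓ = ω ^ 2 := by
    have h1 : ∑ j ∈ Finset.range n, Real.log |xi q ξ j| = Real.log |ω| := by
      rw [hω, Finset.abs_prod, Real.log_prod fun i _ => by
        have := hxi0 i
        rw [xi] at this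
        positivity]
      rfl
    rw [hℓ, hsum, h1, two_mul, Real.exp_add, Real.exp_log (abs_pos.2 hW.ne_zero),
      abs_mul_abs_self, sq]
  have hpos : 0 < ℓ := by
    refine mul_pos two_pos (Finset.sum_pos (fun j _ => Real.log_pos (hxi0 j)) ?_)
    exact Finset.nonempty_Icc.2 hn.1.1
  have hS : Carries S ξ (-1 / ξ) ξ := by
    constructor <;> simp only [coe_S] <;> simp
    field_simp
  set w := S⁻¹ * word q (initial a n) * S with hw
  have hwmem : w ∈ group q :=
    mul_mem (mul_mem (inv_mem (S_mem q)) (word_mem q _)) (S_mem q)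
  have hwξ : Carries w ξ ξ ω := by
    have := (hS.inv.mul hW).mul hS
    rwa [mul_right_comm, inv_mul_cancel₀ hξ0, one_mul] at this
  have key : ∀ t ∈ periods q ξ η hne, ∃ g ∈ group q, ∃ κ, Carries g ξ ξ κ ∧ Carries g η η κ⁻¹ ∧
      κ ^ 2 = Real.exp t ∧ ∃ k : ℤ, (g = w ^ k ∨ g = -w ^ k) ∧ t = k * ℓ := by
    rintro t ⟨-, g, hg, hgs⟩
    obtain ⟨κ, hgξ, hgη, hκ⟩ := (smul_geodesic_iff hne g t).1 hgs
    obtain ⟨k, hk⟩ := eq_zpow_word hq hirr hcode hn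
      (mul_mem (mul_mem (S_mem q) hg) (inv_mem (S_mem q))) ((hS.mul hgξ).mul hS.inv)
    have hwk : w ^ k = S⁻¹ * word q (initial a n) ^ k * S := by
      have := conj_zpow (i := k) (a := S⁻¹) (b := word q (initial a n))
      rwa [inv_inv] at this
    have hgk : g = w ^ k ∨ g = -w ^ k := by
      have e : g = S⁻¹ * (S * g * S⁻¹) * S := by group
      rw [hwk]
      rcases hk with hk | hk <;> rw [hk] at e
      · exact Or.inl e
      · right
        rw [e, mul_neg, neg_mul]
    refine ⟨g, hg, κ, hgξ, hgη, hκ, k, hgk, ?_⟩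
    have hκk : κ ^ 2 = (ω ^ k) ^ 2 := by
      rcases hgk with h | h <;> rw [h] at hgξ
      · rw [(hgξ.unique (hwξ.zpow k)).2]
      · rw [(hgξ.unique (hwξ.zpow k).neg).2, neg_sq]
    apply Real.exp_injective
    rw [← hκ, hκk, mul_comm (k : ℝ), Real.exp_mul, hexp, Real.rpow_intCast, ← zpow_natCast,
      ← zpow_natCast, zpow_comm]
  -- Closedness supplies a hyperbolic `±w^k` fixing `η`; it commutes with `w`, so `w` fixes `η` and
  -- realizes `ℓ`.
  obtain ⟨t₀, ht₀⟩ := hclosed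
  constructor
  · obtain ⟨g, -, κ, hgξ, hgη, hκ, k, hgk, -⟩ := key t₀ ht₀
    refine ⟨hpos, w, hwmem, (smul_geodesic_iff hne w ℓ).2 ⟨ω, hwξ, ?_, hexp.symm⟩⟩
    refine hgξ.of_commute hgη ?_ hwξ hne ?_
    · rw [hκ]
      exact (Real.one_lt_exp_iff.2 ht₀.1).ne'
    · rcases hgk with h | h <;> rw [h]
      · exact ((Commute.refl w).zpow_right k).eq
      · rw [mul_neg, neg_mul, ((Commute.refl w).zpow_right k).eq]
  · intro t htp
    obtain ⟨-, -, -, -, -, -, k, -, hk⟩ := key t htp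
    have h1 : (0 : ℝ) < k := by
      have := htp.1
      rw [hk] at this
      exact pos_of_mul_pos_left this hpos.le
    have h2 : (1 : ℝ) ≤ k := by exact_mod_cast (show 0 < k by exact_mod_cast h1)
    rw [hk]
    nlinarith

end Hecke

theorem mainTheorem9 (q : ℕ) (hq : 3 ≤ q) (ξ η : ℝ) (hne : ξ ≠ η)
    (hred : Hecke.IsStronglyReduced q ξ η) (hclosed : Hecke.IsClosedGeodesic q ξ η hne)
    (n : ℕ) (a : ℕ → ℤ) (hcode : Hecke.HasInfiniteCode q (-1 / ξ) 0 a)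
    (hn : IsLeast {m : ℕ | 0 < m ∧ Function.Periodic a m} n) :
    Hecke.IsLength q ξ η hne (2 * ∑ j ∈ Finset.Icc 1 n, Real.log |Hecke.xi q ξ j|) ∧
    ∃ v : ℕ → ℝ,
      (∀ j ∈ Finset.Icc 1 n, Hecke.ConvergesTo q (fun i => a (i + j)) (v j)) ∧
      Hecke.IsLength q ξ η hne (-Real.log (∏ j ∈ Finset.Icc 1 n, |v j| ^ 2)) := by
  have ht := hcode.isExpansion hq
  have hlen := Hecke.isLength_of_code hq hne hred.1.1 hclosed hcode hn
  -- The `λ`-fraction shifted by `j` digits has the value `F_q^j(Sξ) = -1/ξ_j`.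
  refine ⟨hlen, fun j => (Hecke.F q)^[j] (-1 / ξ), fun j _ => ?_, ?_⟩
  · simpa using (ht.shift j).convergesTo hq
  · convert hlen using 1
    rw [Real.log_prod fun j _ => by have := ht.ne_zero j; positivity, ← Finset.sum_neg_distrib,
      Finset.mul_sum]
    refine Finset.sum_congr rfl fun j _ => ?_
    rw [Hecke.xi, abs_div, abs_neg, abs_one, one_div, Real.log_inv, Real.log_pow]
    push_cast
    ring
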